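/- All graphs are finite and simple. For a graph $G$, the coline graph $\mathrm{co}(G)$ has vertex set $E(G)$, two distinct edges of $G$ being adjacent in $\mathrm{co}(G)$ if and only if they share no endpoint in $G$; a graph is traceable if it has a Hamiltonian path. Write $\cup$ for disjoint union, $K_3^+$ for the triangle with one pendant edge attached, $K_4^-$ for $K_4$ minus an edge, and $K_3\circ K_1$ for the triangle with one pendant edge attached to each of its three vertices. Let $G$ be a graph with $m\ge 2$ edges and maximum degree $\Delta$. Then $\mathrm{co}(G)$ is not traceable if and only if at least one of the following holds: (i) $m<2\Delta-1$; (ii) $m=2\Delta-1$ and two vertices of degree $\Delta$ are adjacent in $G$; (iii) up to isolated vertices, $G$ is isomorphic to one of the nine graphs $K_4\cup K_2$; $K_4$ with a pendant edge attached to a vertex; $K_4$; $K_4^-\cup K_2$; $K_4^-$ with a pendant edge attached to a vertex of degree $2$; $K_3^+\cup K_2$; $K_3^+$ with a pendant edge attached to its vertex of degree $1$ (a triangle with a pendant path of length $2$); $C_4$; $K_3\cup K_2$; (iv) up to isolated vertices, $G$ is isomorphic to $K_3\circ K_1$. -/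

import Mathlib

namespace Coline

/-- The coline graph `co(G)`: the complement of the line graph of `G`. Its vertices are the edges
of `G`; two distinct edges are adjacent in it iff they have no common endpoint. -/
def coline {V : Type*} (G : SimpleGraph V) : SimpleGraph G.edgeSet :=
  G.lineGraphᶜ

/-- A graph is traceable if it has a Hamiltonian path: a walk through every vertex exactly once. -/
def Traceable {α : Type*} [DecidableEq α] (L : SimpleGraph α) : Prop :=
  ∃ (a b : α) (p : L.Walk a b), p.IsHamiltonian

/-- The graph on `Fin n` with the given edges. -/
def graphOfEdges (n : ℕ) (E : Finset (Sym2 (Fin n))) : SimpleGraph (Fin n) :=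
  SimpleGraph.fromEdgeSet (E : Set (Sym2 (Fin n)))

/-- `G` is a copy of `H` up to isolated vertices: deleting the isolated vertices of `G` leaves a
graph isomorphic to `H`. (It is applied only to graphs `H` without isolated vertices. Isolated
vertices of `G` change neither `co(G)` nor the number of edges nor the maximum degree.) -/
def IsCopy {V W : Type*} (G : SimpleGraph V) (H : SimpleGraph W) : Prop :=
  Nonempty (G.induce G.support ≃g H)

/-- `K₄ ∪ K₂`. -/
def K4UnionK2 : SimpleGraph (Fin 6) :=
  graphOfEdges 6 {s(0, 1), s(0, 2), s(0, 3), s(1, 2), s(1, 3), s(2, 3), s(4, 5)}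

/-- `K₄` with a pendant edge attached to one vertex. -/
def K4Pendant : SimpleGraph (Fin 5) :=
  graphOfEdges 5 {s(0, 1), s(0, 2), s(0, 3), s(1, 2), s(1, 3), s(2, 3), s(3, 4)}

/-- `K₄`. -/
def K4 : SimpleGraph (Fin 4) :=
  graphOfEdges 4 {s(0, 1), s(0, 2), s(0, 3), s(1, 2), s(1, 3), s(2, 3)}

/-- `K₄⁻ ∪ K₂`, where `K₄⁻` is `K₄` minus an edge (here the 4-cycle `0123` with chord `02`). -/
def K4MinusUnionK2 : SimpleGraph (Fin 6) :=
  graphOfEdges 6 {s(0, 1), s(1, 2), s(2, 3), s(0, 3), s(0, 2), s(4, 5)}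

/-- `K₄⁻` with a pendant edge attached to a vertex of degree 2. -/
def K4MinusPendant : SimpleGraph (Fin 5) :=
  graphOfEdges 5 {s(0, 1), s(1, 2), s(2, 3), s(0, 3), s(0, 2), s(3, 4)}

/-- `K₃⁺ ∪ K₂`, where `K₃⁺` is a triangle with one pendant edge. -/
def K3PlusUnionK2 : SimpleGraph (Fin 6) :=
  graphOfEdges 6 {s(0, 1), s(1, 2), s(0, 2), s(2, 3), s(4, 5)}

/-- `K₃⁺` with a further edge attached to its vertex of degree 1, that is, a triangle with a
pendant path of length 2. -/
def K3PlusPendant : SimpleGraph (Fin 5) :=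
  graphOfEdges 5 {s(0, 1), s(1, 2), s(0, 2), s(2, 3), s(3, 4)}

/-- The 4-cycle `C₄`. -/
def C4 : SimpleGraph (Fin 4) :=
  graphOfEdges 4 {s(0, 1), s(1, 2), s(2, 3), s(0, 3)}

/-- `K₃ ∪ K₂`. -/
def K3UnionK2 : SimpleGraph (Fin 5) :=
  graphOfEdges 5 {s(0, 1), s(1, 2), s(0, 2), s(3, 4)}

/-- `K₃ ∘ K₁`: a triangle with one pendant edge attached to each of its three vertices. -/
def K3CoronaK1 : SimpleGraph (Fin 6) :=
  graphOfEdges 6 {s(0, 1), s(1, 2), s(0, 2), s(0, 3), s(1, 4), s(2, 5)}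

/-- `G` is one of the nine sporadic graphs (up to isolated vertices). -/
def IsSporadic {V : Type*} (G : SimpleGraph V) : Prop :=
  IsCopy G K4UnionK2 ∨ IsCopy G K4Pendant ∨ IsCopy G K4 ∨
    IsCopy G K4MinusUnionK2 ∨ IsCopy G K4MinusPendant ∨
    IsCopy G K3PlusUnionK2 ∨ IsCopy G K3PlusPendant ∨
    IsCopy G C4 ∨ IsCopy G K3UnionK2

end Coline

/-! A Hamiltonian path of co(G) is an ordering of the edges of G in which consecutive edges are
disjoint. The obstructions are quick: edges at one vertex are never consecutive, so m ≥ 2Δ - 1;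
under (ii) the edge joining the two vertices meets every other edge; the ten exceptional graphs are
settled by exhaustive search.

Conversely, induct on m by deleting an edge uv. If uv cannot be inserted into an ordering of the
other edges, a cut-and-reverse argument shows that uv, the first edge, and the successors of all
edges disjoint from uv pairwise intersect (`exists_unrelated_of_no_insertion`). These are m + 3 -
d(u) - d(v) edges. If d(u) + d(v) < m, there are at least four, so they form a star at u or v
(`star_of_intersecting`), and m + 3 is at most 2d(u) + d(v) or d(u) + 2d(v).

A good choice of uv contradicts this. For m > 2Δ, take v of minimum positive degree. For Δ ≥ 4 and m
equal to 2Δ or 2Δ - 1, take u of degree Δ and a neighbour v of degree at most 2; if there is none,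
then m = 2Δ and any edge avoiding u works. When m = 2Δ - 1 the bound can be attained, and the
ordering has to be compared with its reversal.

What remains is finite and evaluated by the kernel: Δ ≤ 3 with m equal to 2Δ - 1 or 2Δ, and the
one-edge extensions of the exceptional graphs, needed when the deletion leaves one of them. -/

namespace Coline

/-! ### Concrete edge lists and the finite checks -/

/-- Two pairs, read as edges, have no common endpoint. -/
def pairDisjoint (p q : ℕ × ℕ) : Bool :=
  p.1 != q.1 && p.1 != q.2 && p.2 != q.1 && p.2 != q.2

/-- Two pairs are the same edge. -/
def pairSame (p q : ℕ × ℕ) : Bool :=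
  (p.1 == q.1 && p.2 == q.2) || (p.1 == q.2 && p.2 == q.1)

/-- Search for an ordering of `rest` that extends a path ending in `a`. -/
def pathFrom : ℕ → ℕ × ℕ → List (ℕ × ℕ) → Bool
  | 0, _, rest => rest.isEmpty
  | k + 1, a, rest => rest.isEmpty ||
      rest.any fun f => pairDisjoint a f && pathFrom k f (rest.erase f)

/-- Search for an ordering of the edge list in which consecutive edges are disjoint. -/
def hasPath (L : List (ℕ × ℕ)) : Bool :=
  L.any fun a => pathFrom L.length a (L.erase a)

/-- The degree of `i` in an edge list. -/
def listDeg (L : List (ℕ × ℕ)) (i : ℕ) : ℕ :=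
  L.countP fun p => p.1 == i || p.2 == i

/-- The image of a pair under the map given by the list of values `σ`. -/
def pairMap (σ : List ℕ) (q : ℕ × ℕ) : ℕ × ℕ := (σ.getD q.1 0, σ.getD q.2 0)

/-- `σ` embeds the graph `H` in the graph `C`, covering all edges of `C`. -/
def isoCheck (C H : ℕ × List (ℕ × ℕ)) (σ : List ℕ) : Bool :=
  σ.length == H.1 && decide σ.Nodup && (σ.all fun x => decide (x < C.1)) &&
    H.2.length == C.2.length && C.2.all fun p => H.2.any fun q => pairSame p (pairMap σ q)

/-- Backtracking search for `σ` with `isoCheck C H σ`. -/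
def isoSearch (C H : ℕ × List (ℕ × ℕ)) : ℕ → List ℕ → Bool
  | 0, σ => isoCheck C H σ
  | k + 1, σ => (List.range C.1).any fun x =>
      (!σ.contains x) && (listDeg C.2 x == listDeg H.2 σ.length) &&
      (H.2.all fun q => !(decide (q.1 ≤ σ.length) && decide (q.2 ≤ σ.length)) ||
        C.2.any fun p => pairSame p (pairMap (σ ++ [x]) q)) &&
      isoSearch C H k (σ ++ [x])

/-- The ten exceptional graphs, each with its number of vertices. -/
def exceptionalCodes : List (ℕ × List (ℕ × ℕ)) :=
  [(6, [(0, 1), (0, 2), (0, 3), (1, 2), (1, 3), (2, 3), (4, 5)]),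
   (5, [(0, 1), (0, 2), (0, 3), (1, 2), (1, 3), (2, 3), (3, 4)]),
   (4, [(0, 1), (0, 2), (0, 3), (1, 2), (1, 3), (2, 3)]),
   (6, [(0, 1), (1, 2), (2, 3), (0, 3), (0, 2), (4, 5)]),
   (5, [(0, 1), (1, 2), (2, 3), (0, 3), (0, 2), (3, 4)]),
   (6, [(0, 1), (1, 2), (0, 2), (2, 3), (4, 5)]),
   (5, [(0, 1), (1, 2), (0, 2), (2, 3), (3, 4)]),
   (4, [(0, 1), (1, 2), (2, 3), (0, 3)]),
   (5, [(0, 1), (1, 2), (0, 2), (3, 4)]),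
   (6, [(0, 1), (1, 2), (0, 2), (0, 3), (1, 4), (2, 5)])]

/-- The coded graph has a vertex of too large degree, or two adjacent vertices of the critical
degree, or a traceable coline graph, or it is exceptional. -/
def codeOk (C : ℕ × List (ℕ × ℕ)) : Bool :=
  ((List.range C.1).any fun i => decide (C.2.length + 1 < 2 * listDeg C.2 i)) ||
  (C.2.any fun p => (2 * listDeg C.2 p.1 == C.2.length + 1) &&
    (2 * listDeg C.2 p.2 == C.2.length + 1)) ||
  hasPath C.2 ||
  exceptionalCodes.any fun H => H.1 == C.1 && H.2.length == C.2.length && isoSearch C H H.1 []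

/-- All ways of adding an edge to a coded graph, with at most two new vertices. -/
def codeExts (C : ℕ × List (ℕ × ℕ)) : List (ℕ × List (ℕ × ℕ)) :=
  (C.1 + 2, (C.1, C.1 + 1) :: C.2) ::
    ((List.range C.1).map fun i => (C.1 + 1, (i, C.1) :: C.2)) ++
    (List.range C.1).flatMap fun j => (List.range j).filterMap fun i =>
      if C.2.any (pairSame (i, j)) then none else some (C.1, (i, j) :: C.2)

/-- The star with `d` edges. -/
def starCode (d : ℕ) : ℕ × List (ℕ × ℕ) := (d + 1, (List.range d).map fun i => (0, i + 1))

/-- All extensions by `k` edges pass the check. -/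
def extsOk : ℕ → ℕ × List (ℕ × ℕ) → Bool
  | 0, C => codeOk C
  | k + 1, C => (codeExts C).all (extsOk k)

/-- Settles the induction step when deleting an edge leaves an exceptional graph. -/
theorem exceptional_exts_ok : exceptionalCodes.all (extsOk 1) = true := by
  decide +kernel

/-- A graph with maximum degree Δ is a star with Δ edges plus m - Δ further edges. The five checks
are the pairs (m, Δ) with m ≥ 2, Δ ≤ 3 and 2Δ - 1 ≤ m ≤ 2Δ. -/
theorem star_exts_ok :
    (extsOk 1 (starCode 1) && extsOk 1 (starCode 2) && extsOk 2 (starCode 2) &&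
      extsOk 2 (starCode 3) && extsOk 3 (starCode 3)) = true := by
  decide +kernel

theorem exceptional_no_path : (exceptionalCodes.all fun H => !hasPath H.2) = true := by
  decide +kernel

/-! ### Orderings and the insertion lemma -/

section Insertion

variable {α : Type*} {r : α → α → Prop}

/-- Symmetry keeps the turned block a chain, so only the junctions matter. Empty `Y` is plain
insertion; this is why the last junction is phrased with `e :: Y.reverse`. -/
theorem isChain_insert_reversed (hr : ∀ a b, r a b → r b a) {X Y Z : List α} {e : α}
    (hl : (X ++ Y ++ Z).IsChain r) (hX : ∀ x ∈ X.getLast?, r x e)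
    (hY : ∀ y ∈ Y.getLast?, r e y) (hZ : ∀ y ∈ (e :: Y.reverse).getLast?, ∀ z ∈ Z.head?, r y z) :
    (X ++ e :: Y.reverse ++ Z).IsChain r := by
  rw [List.isChain_append, List.isChain_append] at hl
  obtain ⟨⟨h1, h2, -⟩, h3, -⟩ := hl
  rw [List.isChain_append, List.isChain_append, List.isChain_cons, List.isChain_reverse]
  refine ⟨⟨h1, ⟨?_, h2.imp fun a b => hr a b⟩, ?_⟩, h3, ?_⟩
  · simpa using hY
  · simpa using hX
  · intro y hy
    rw [List.getLast?_append] at hy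
    refine hZ y ?_
    rcases h : (e :: Y.reverse).getLast? with _ | w
    · simp at h
    · rw [h] at hy
      simpa using hy

/-- Position `i` is a gap where `e` may follow what precedes. If `e` were related to `l[i]`, it
would fit there. If `j` is a later such gap and `l[i]`, `l[j]` were related, one could put `e` at
`i`, reverse the block from `i` to `j - 1`, and continue with `l[j]`. -/
theorem not_rel_of_no_insertion (hr : ∀ a b, r a b → r b a) {l : List α} {e : α}
    (hl : l.IsChain r) (hno : ∀ l' : List α, l'.Perm (e :: l) → ¬ l'.IsChain r)
    {i : ℕ} (hi : i < l.length) (hie : ∀ h : 0 < i, r l[i - 1] e) :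
    ¬ r e l[i] ∧ ∀ j (hj : j < l.length), i < j → r l[j - 1] e → ¬ r l[i] l[j] := by
  have hX : ∀ x ∈ (l.take i).getLast?, r x e := by
    intro x hx
    rw [List.getLast?_take] at hx
    split_ifs at hx with h0
    · simp at hx
    · rw [List.getElem?_eq_getElem (by omega)] at hx
      simp only [Option.some_or, Option.mem_def, Option.some.injEq] at hx
      exact hx ▸ hie (by omega)
  constructor
  · intro h
    refine hno (l.take i ++ e :: ([] : List α).reverse ++ l.drop i) ?_
      (isChain_insert_reversed hr (by simpa using hl) hX (by simp) ?_)
    · simpa using List.perm_middle (l₁ := l.take i) (l₂ := l.drop i) (a := e)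
    · simpa [List.head?_drop, List.getElem?_eq_getElem hi] using h
  · intro j hj hij hje h
    obtain ⟨k, rfl⟩ : ∃ k, j = i + 1 + k := ⟨j - (i + 1), by omega⟩
    have hsplit : l.take i ++ (l.drop i).take (k + 1) ++ l.drop (i + 1 + k) = l := by
      conv_rhs => rw [← List.take_append_drop i l, ← List.take_append_drop (k + 1) (l.drop i)]
      rw [List.append_assoc, List.drop_drop]
      congr 3
      omega
    refine hno (l.take i ++ e :: ((l.drop i).take (k + 1)).reverse ++ l.drop (i + 1 + k)) ?_
      (isChain_insert_reversed hr (by rwa [hsplit]) hX ?_ ?_)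
    · conv_rhs => rw [← hsplit]
      rw [List.append_assoc, List.append_assoc, List.cons_append]
      refine List.perm_middle.trans (List.Perm.cons _ ?_)
      exact List.Perm.append_left _ (List.Perm.append_right _ (List.reverse_perm _))
    · intro y hy
      rw [List.getLast?_take] at hy
      simp only [Nat.add_eq_zero_iff, one_ne_zero, and_false, if_false, Nat.add_sub_cancel,
        List.getElem?_drop] at hy
      rw [List.getElem?_eq_getElem (by omega)] at hy
      simp only [Option.some_or, Option.mem_def, Option.some.injEq] at hy
      subst hy
      refine hr _ _ ?_
      convert hje using 2
      omega
    · intro y hy z hz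
      rw [List.head?_drop, List.getElem?_eq_getElem hj] at hz
      have hne : (l.drop i).take (k + 1) = l[i] :: ((l.drop (i + 1)).take k) := by
        rw [List.drop_eq_getElem_cons hi, List.take_succ_cons]
      rw [hne] at hy
      simp only [Option.mem_def, Option.some.injEq] at hz
      simp [List.getLast?_cons, List.getLast?_append] at hy
      subst hy hz
      exact h

/-- If `e` cannot be inserted into the chain `l`, then `e`, the head of `l` and the successors in
`l` of the elements related to `e` are pairwise unrelated. -/
theorem exists_unrelated_of_no_insertion [DecidableEq α] (hr : ∀ a b, r a b → r b a)
    {l : List α} {e : α} (hl : l.IsChain r) (hnd : l.Nodup) (he : e ∉ l) (hne : l ≠ [])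
    (hno : ∀ l' : List α, l'.Perm (e :: l) → ¬ l'.IsChain r) (F : Finset α)
    (hF : ∀ x, x ∈ F ↔ x ∈ l ∧ r x e) :
    ∃ A : Finset α, A.card = F.card + 2 ∧
      (∀ x, x ∈ A ↔ x = e ∨ ∃ (i : ℕ) (h : i < l.length), x = l[i] ∧ ∀ _ : 0 < i, r l[i - 1] e) ∧
      ∀ x ∈ A, ∀ y ∈ A, x ≠ y → ¬ r x y := by
  classical
  have hpos : 0 < l.length := List.length_pos_iff.2 hne
  set p : ℕ → α := fun i => l.getD i e with hp
  have hpi : ∀ i (h : i < l.length), p i = l[i] := fun i h => by simp [hp, h]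
  have hinj : ∀ i j, i < l.length → j < l.length → p i = p j → i = j := by
    intro i j hi hj h
    rw [hpi i hi, hpi j hj] at h
    exact (hnd.getElem_inj_iff).1 h
  -- Otherwise `e` could be appended at the end; so every element related to `e` has a successor.
  have hlast : ∀ i (h : i < l.length), r l[i] e → i + 1 < l.length := by
    intro i h hie
    by_contra hcon
    refine hno (l ++ [e]) (by simp) ?_
    rw [List.isChain_append]
    refine ⟨hl, by simp, ?_⟩
    intro x hx y hy
    have hi : i = l.length - 1 := by omega
    subst hi
    rw [List.getLast?_eq_getElem?, List.getElem?_eq_getElem (by omega)] at hx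
    simp only [Option.mem_def, Option.some.injEq, List.head?_cons] at hx hy
    subst hx hy
    exact hie
  set J : Finset ℕ := (Finset.range l.length).filter fun i => r (p i) e with hJ
  have hFJ : F.card = J.card := by
    have : F = J.image p := by
      ext x
      rw [hF, Finset.mem_image]
      constructor
      · rintro ⟨hx, hxe⟩
        obtain ⟨i, hi, rfl⟩ := List.getElem_of_mem hx
        exact ⟨i, by simp [hJ, hi, hpi i hi, hxe], hpi i hi⟩
      · rintro ⟨i, hi, rfl⟩
        simp only [hJ, Finset.mem_filter, Finset.mem_range] at hi
        exact ⟨by rw [hpi i hi.1]; exact List.getElem_mem _, hi.2⟩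
    rw [this, Finset.card_image_of_injOn]
    intro i hi j hj h
    simp only [hJ, Finset.coe_filter, Finset.mem_range, Set.mem_ofPred_eq] at hi hj
    exact hinj i j hi.1 hj.1 h
  -- Successor positions are never 0, so the head adds one more position, and `e` itself yields the
  -- second unit of `F.card + 2`.
  set I : Finset ℕ := insert 0 (J.image (· + 1)) with hI
  have hIlt : ∀ i ∈ I, i < l.length := by
    intro i hi
    simp only [hI, Finset.mem_insert, Finset.mem_image, hJ, Finset.mem_filter,
      Finset.mem_range] at hi
    rcases hi with rfl | ⟨j, ⟨hj, hje⟩, rfl⟩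
    · exact hpos
    · exact hlast j hj (by rwa [hpi j hj] at hje)
  have hmemI : ∀ i (h : i < l.length), i ∈ I ↔ ∀ _ : 0 < i, r l[i - 1] e := by
    intro i hi
    simp only [hI, Finset.mem_insert, Finset.mem_image, hJ, Finset.mem_filter, Finset.mem_range]
    constructor
    · rintro (rfl | ⟨j, ⟨hj, hje⟩, rfl⟩) h0
      · omega
      · rw [hpi j hj] at hje
        simpa using hje
    · intro h
      rcases Nat.eq_zero_or_pos i with h0 | h0
      · exact Or.inl h0
      · refine Or.inr ⟨i - 1, ⟨by omega, ?_⟩, by omega⟩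
        rw [hpi _ (by omega)]
        exact h h0
  have hA : ∀ x, x ∈ insert e (I.image p) ↔
      x = e ∨ ∃ (i : ℕ) (h : i < l.length), x = l[i] ∧ ∀ _ : 0 < i, r l[i - 1] e := by
    intro x
    rw [Finset.mem_insert, Finset.mem_image]
    refine or_congr Iff.rfl ⟨?_, ?_⟩
    · rintro ⟨i, hi, rfl⟩
      exact ⟨i, hIlt i hi, hpi i (hIlt i hi), (hmemI i (hIlt i hi)).1 hi⟩
    · rintro ⟨i, hi, rfl, h⟩
      exact ⟨i, (hmemI i hi).2 h, hpi i hi⟩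
  refine ⟨insert e (I.image p), ?_, hA, ?_⟩
  · rw [Finset.card_insert_of_notMem, Finset.card_image_of_injOn, hI, Finset.card_insert_of_notMem,
      Finset.card_image_of_injective _ (add_left_injective 1), hFJ]
    · simp
    · intro i hi j hj h
      exact hinj i j (hIlt i hi) (hIlt j hj) h
    · rw [Finset.mem_image]
      rintro ⟨i, hi, h⟩
      rw [hpi i (hIlt i hi)] at h
      exact he (h ▸ List.getElem_mem _)
  · intro x hx y hy hxy
    rcases (hA x).1 hx with rfl | ⟨i, hi, rfl, hie⟩
    · rcases (hA y).1 hy with rfl | ⟨j, hj, rfl, hje⟩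
      · exact absurd rfl hxy
      · exact (not_rel_of_no_insertion hr hl hno hj hje).1
    · rcases (hA y).1 hy with rfl | ⟨j, hj, rfl, hje⟩
      · exact fun h => (not_rel_of_no_insertion hr hl hno hi hie).1 (hr _ _ h)
      · rcases lt_trichotomy i j with h | h | h
        · exact (not_rel_of_no_insertion hr hl hno hi hie).2 j hj h (hje (by omega))
        · subst h
          exact absurd rfl hxy
        · exact fun h' =>
            (not_rel_of_no_insertion hr hl hno hj hje).2 i hi h (hie (by omega)) (hr _ _ h')

end Insertion

/-! ### Finite sets of edges -/

section EdgeSets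

variable {V : Type*}

/-- Two edges without a common endpoint. -/
def EdgeDisjoint (e f : Sym2 V) : Prop := ∀ x ∈ e, x ∉ f

theorem EdgeDisjoint.symm {e f : Sym2 V} (h : EdgeDisjoint e f) : EdgeDisjoint f e :=
  fun x hx hx' => h x hx' hx

theorem edgeDisjoint_mk_right {e : Sym2 V} {u v : V} :
    EdgeDisjoint e s(u, v) ↔ u ∉ e ∧ v ∉ e := by
  constructor
  · intro h
    exact ⟨fun hu => h u hu (by simp), fun hv => h v hv (by simp)⟩
  · rintro ⟨hu, hv⟩ x hx hx'
    rcases Sym2.mem_iff.1 hx' with rfl | rfl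
    · exact hu hx
    · exact hv hx

theorem not_isDiag_exists {e : Sym2 V} (he : ¬ e.IsDiag) {a : V} (ha : a ∈ e) :
    ∃ b, b ≠ a ∧ e = s(a, b) := by
  obtain ⟨b, rfl⟩ := Sym2.mem_iff_exists.1 ha
  exact ⟨b, fun h => he (by simp [h]), rfl⟩

theorem ne_of_edge {S : Finset (Sym2 V)} (hS : ∀ e ∈ S, ¬ e.IsDiag) {u v : V}
    (h : s(u, v) ∈ S) : u ≠ v :=
  fun h' => hS _ h (by simp [h'])

variable [DecidableEq V]

/-- The edges in `S` can be ordered so that consecutive ones are disjoint. -/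
def HasOrdering (S : Finset (Sym2 V)) : Prop :=
  ∃ l : List (Sym2 V), l.Nodup ∧ l.toFinset = S ∧ l.IsChain EdgeDisjoint

/-- The number of edges in `S` at the vertex `v`. -/
def edgeDeg (S : Finset (Sym2 V)) (v : V) : ℕ := (S.filter (v ∈ ·)).card

theorem edgeDeg_le_card (S : Finset (Sym2 V)) (v : V) : edgeDeg S v ≤ S.card :=
  Finset.card_filter_le _ _

theorem edgeDeg_pos {S : Finset (Sym2 V)} {e : Sym2 V} (he : e ∈ S) {v : V} (hv : v ∈ e) :
    0 < edgeDeg S v :=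
  Finset.card_pos.2 ⟨e, by simp [he, hv]⟩

theorem edgeDeg_erase_of_mem {S : Finset (Sym2 V)} {e : Sym2 V} (he : e ∈ S) {v : V}
    (hv : v ∈ e) : edgeDeg (S.erase e) v + 1 = edgeDeg S v := by
  unfold edgeDeg
  rw [Finset.filter_erase]
  exact Finset.card_erase_add_one (by simp [he, hv])

theorem edgeDeg_erase_le (S : Finset (Sym2 V)) (e : Sym2 V) (v : V) :
    edgeDeg (S.erase e) v ≤ edgeDeg S v :=
  Finset.card_le_card (Finset.filter_subset_filter _ (Finset.erase_subset _ _))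

/-- Inclusion–exclusion: only the edge uv can be counted twice. -/
theorem edgeDeg_add_edgeDeg (S : Finset (Sym2 V)) {u v : V} (huv : u ≠ v) :
    edgeDeg S u + edgeDeg S v =
      (S.filter fun e => u ∈ e ∨ v ∈ e).card + (S.filter fun e => e = s(u, v)).card := by
  unfold edgeDeg
  rw [← Finset.card_union_add_card_inter, ← Finset.filter_or, ← Finset.filter_and]
  congr 2
  ext e
  simp [Sym2.mem_and_mem_iff huv]

theorem card_disjoint_add_edgeDeg {S : Finset (Sym2 V)} {u v : V} (huv : u ≠ v)
    (h : s(u, v) ∈ S) :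
    (S.filter fun e => u ∉ e ∧ v ∉ e).card + edgeDeg S u + edgeDeg S v = S.card + 1 := by
  have h1 := edgeDeg_add_edgeDeg S huv
  have h2 : (S.filter fun e => e = s(u, v)).card = 1 := by
    rw [Finset.filter_eq' S, if_pos h, Finset.card_singleton]
  have h3 := Finset.card_filter_add_card_filter_not (s := S) (fun e => u ∈ e ∨ v ∈ e)
  simp only [not_or] at h3
  omega

theorem edgeDeg_add_le {S : Finset (Sym2 V)} {u v : V} (huv : u ≠ v) (h : s(u, v) ∉ S) :
    edgeDeg S u + edgeDeg S v ≤ S.card := by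
  have h1 := edgeDeg_add_edgeDeg S huv
  have h2 : (S.filter fun e => e = s(u, v)).card = 0 := by
    rw [Finset.filter_eq' S, if_neg h, Finset.card_empty]
  have h3 := Finset.card_filter_le S (fun e => u ∈ e ∨ v ∈ e)
  omega

theorem sum_edgeDeg_le (S : Finset (Sym2 V)) (X : Finset V) :
    ∑ x ∈ X, edgeDeg S x ≤ 2 * S.card := by
  have h : ∑ x ∈ X, edgeDeg S x = ∑ e ∈ S, (X.filter (· ∈ e)).card :=
    Finset.sum_card_bipartiteAbove_eq_sum_card_bipartiteBelow (fun x e => x ∈ e)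
  rw [h, mul_comm]
  refine Finset.sum_le_card_nsmul _ _ 2 ?_
  intro e _
  induction e with
  | _ a b =>
    refine le_trans (Finset.card_le_card (t := {a, b}) ?_) Finset.card_le_two
    intro x hx
    simpa using (Finset.mem_filter.1 hx).2

/-- The neighbours of `u` in `S`. -/
def edgeNbrs (S : Finset (Sym2 V)) (u : V) : Finset V :=
  ((S.filter (u ∈ ·)).biUnion fun e => e.toFinset).erase u

theorem mem_edgeNbrs {S : Finset (Sym2 V)} (hS : ∀ e ∈ S, ¬ e.IsDiag) {u x : V} :
    x ∈ edgeNbrs S u ↔ s(u, x) ∈ S := by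
  simp only [edgeNbrs, Finset.mem_erase, Finset.mem_biUnion, Finset.mem_filter, Sym2.mem_toFinset]
  constructor
  · rintro ⟨hx, e, ⟨he, hu⟩, hxe⟩
    rwa [← (Sym2.mem_and_mem_iff (Ne.symm hx)).1 ⟨hu, hxe⟩]
  · intro h
    exact ⟨fun hx => hS _ h (by simp [hx]), s(u, x), ⟨h, by simp⟩, by simp⟩

theorem filter_mem_eq_image {S : Finset (Sym2 V)} (hS : ∀ e ∈ S, ¬ e.IsDiag) (u : V) :
    S.filter (u ∈ ·) = (edgeNbrs S u).image fun x => s(u, x) := by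
  ext e
  simp only [Finset.mem_filter, Finset.mem_image, mem_edgeNbrs hS]
  constructor
  · rintro ⟨he, hu⟩
    obtain ⟨x, -, rfl⟩ := not_isDiag_exists (hS e he) hu
    exact ⟨x, he, rfl⟩
  · rintro ⟨x, hx, rfl⟩
    exact ⟨hx, by simp⟩

theorem card_edgeNbrs {S : Finset (Sym2 V)} (hS : ∀ e ∈ S, ¬ e.IsDiag) (u : V) :
    (edgeNbrs S u).card = edgeDeg S u := by
  unfold edgeDeg
  rw [filter_mem_eq_image hS, Finset.card_image_of_injective]
  intro x y h
  exact Sym2.congr_right.1 h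

/-- A pairwise intersecting family of at least four edges is a star. -/
theorem star_of_intersecting {A : Finset (Sym2 V)} (hA : ∀ e ∈ A, ¬ e.IsDiag)
    (hint : ∀ x ∈ A, ∀ y ∈ A, x ≠ y → ¬ EdgeDisjoint x y) {u v : V} (huv : s(u, v) ∈ A)
    (hcard : 4 ≤ A.card) : (∀ e ∈ A, u ∈ e) ∨ (∀ e ∈ A, v ∈ e) := by
  by_contra! hcon
  obtain ⟨⟨a, ha, hua⟩, b, hb, hvb⟩ := hcon
  have hne : u ≠ v := fun h => hA _ huv (by simp [h])
  have hmeet : ∀ x ∈ A, ∀ y ∈ A, ∃ z, z ∈ x ∧ z ∈ y := by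
    intro x hx y hy
    by_cases hxy : x = y
    · subst hxy
      exact ⟨x.out.1, Sym2.out_fst_mem x, Sym2.out_fst_mem x⟩
    · have := hint x hx y hy hxy
      unfold EdgeDisjoint at this
      push Not at this
      exact this
  have hva : ∀ c ∈ A, u ∉ c → v ∈ c := by
    intro c hc huc
    obtain ⟨z, hz, hz'⟩ := hmeet c hc _ huv
    rcases Sym2.mem_iff.1 hz' with rfl | rfl
    · exact absurd hz huc
    · exact hz
  have hub : ∀ c ∈ A, v ∉ c → u ∈ c := by
    intro c hc hvc
    obtain ⟨z, hz, hz'⟩ := hmeet c hc _ huv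
    rcases Sym2.mem_iff.1 hz' with rfl | rfl
    · exact hz
    · exact absurd hz hvc
  -- The member missing u is vx. One missing v contains u and meets vx, so it is ux. All members
  -- then lie in the triangle uvx, which has too few edges.
  obtain ⟨x, hxv, rfl⟩ := not_isDiag_exists (hA a ha) (hva a ha hua)
  have hb' : ∀ c ∈ A, v ∉ c → c = s(u, x) := by
    intro c hc hvc
    obtain ⟨y, -, rfl⟩ := not_isDiag_exists (hA c hc) (hub c hc hvc)
    obtain ⟨z, hz, hz'⟩ := hmeet _ ha _ hc
    rcases Sym2.mem_iff.1 hz with rfl | rfl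
    · exact absurd hz' hvc
    · rcases Sym2.mem_iff.1 hz' with rfl | rfl
      · exact absurd hz hua
      · rfl
  have hbe := hb' b hb hvb
  subst hbe
  have ha' : ∀ c ∈ A, u ∉ c → c = s(v, x) := by
    intro c hc huc
    obtain ⟨y, -, rfl⟩ := not_isDiag_exists (hA c hc) (hva c hc huc)
    obtain ⟨z, hz, hz'⟩ := hmeet _ hb _ hc
    rcases Sym2.mem_iff.1 hz with rfl | rfl
    · exact absurd hz' huc
    · rcases Sym2.mem_iff.1 hz' with rfl | rfl
      · exact absurd hz hvb
      · rfl
  have hsub : A ⊆ {s(u, v), s(v, x), s(u, x)} := by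
    intro c hc
    simp only [Finset.mem_insert, Finset.mem_singleton]
    by_cases h1 : u ∈ c
    · by_cases h2 : v ∈ c
      · exact Or.inl ((Sym2.mem_and_mem_iff hne).1 ⟨h1, h2⟩)
      · exact Or.inr (Or.inr (hb' c hc h2))
    · exact Or.inr (Or.inl (ha' c hc h1))
  have := (Finset.card_le_card hsub).trans Finset.card_le_three
  omega

/-- The insertion lemma for edges: if `S` without the edge `uv` can be ordered and `S` cannot, and
`u`, `v` do not meet almost all edges, then a full family of edges forms a star at `u` or `v`. -/
theorem exists_star_of_not_hasOrdering {S : Finset (Sym2 V)} (hS : ∀ e ∈ S, ¬ e.IsDiag)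
    {u v : V} (huv : s(u, v) ∈ S) {l : List (Sym2 V)} (hnd : l.Nodup)
    (hlS : l.toFinset = S.erase s(u, v)) (hl : l.IsChain EdgeDisjoint) (hno : ¬ HasOrdering S)
    (hlt : edgeDeg S u + edgeDeg S v < S.card) :
    ∃ A : Finset (Sym2 V), A.card + edgeDeg S u + edgeDeg S v = S.card + 3 ∧
      (∀ x, x ∈ A ↔ x = s(u, v) ∨ ∃ (i : ℕ) (h : i < l.length), x = l[i] ∧
        ∀ _ : 0 < i, EdgeDisjoint l[i - 1] s(u, v)) ∧ A ⊆ S ∧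
      ((∀ e ∈ A, u ∈ e) ∨ (∀ e ∈ A, v ∈ e)) := by
  have hne : u ≠ v := fun h => hS _ huv (by simp [h])
  have hmem : ∀ x, x ∈ l ↔ x ≠ s(u, v) ∧ x ∈ S := by
    intro x
    rw [← List.mem_toFinset, hlS, Finset.mem_erase]
  have hel : s(u, v) ∉ l := fun h => ((hmem _).1 h).1 rfl
  have hlne : l ≠ [] := by
    rintro rfl
    have h1 : 0 = (S.erase s(u, v)).card := by rw [← hlS]; simp
    rw [Finset.card_erase_of_mem huv] at h1
    have := edgeDeg_pos huv (v := u) (by simp)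
    omega
  have hno' : ∀ l' : List (Sym2 V), l'.Perm (s(u, v) :: l) → ¬ l'.IsChain EdgeDisjoint := by
    intro l' hp hc
    refine hno ⟨l', hp.nodup_iff.2 (List.nodup_cons.2 ⟨hel, hnd⟩), ?_, hc⟩
    rw [List.toFinset_eq_of_perm _ _ hp, List.toFinset_cons, hlS, Finset.insert_erase huv]
  obtain ⟨A, hc, hA, hp⟩ := exists_unrelated_of_no_insertion
    (fun a b (h : EdgeDisjoint a b) => h.symm) hl hnd hel hlne hno'
    (S.filter fun e => u ∉ e ∧ v ∉ e) (by
      intro x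
      rw [Finset.mem_filter, hmem, edgeDisjoint_mk_right]
      constructor
      · rintro ⟨h1, h2⟩
        exact ⟨⟨by rintro rfl; simp at h2, h1⟩, h2⟩
      · rintro ⟨h1, h2⟩
        exact ⟨h1.2, h2⟩)
  have hcd := card_disjoint_add_edgeDeg hne huv
  have hAS : A ⊆ S := by
    intro x hx
    rcases (hA x).1 hx with rfl | ⟨i, hi, rfl, -⟩
    · exact huv
    · exact ((hmem _).1 (List.getElem_mem hi)).2
  refine ⟨A, by omega, hA, hAS, ?_⟩
  -- There are m + 1 - d(u) - d(v) edges disjoint from uv, so the family has m + 3 - d(u) - d(v)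
  -- members, at least four by `hlt`.
  exact star_of_intersecting (fun e he => hS e (hAS he)) hp ((hA _).2 (Or.inl rfl)) (by omega)

/-- A star at u or v has at most d(u) or d(v) edges; compare with the size of the family. -/
theorem degree_bound_of_not_hasOrdering {S : Finset (Sym2 V)} (hS : ∀ e ∈ S, ¬ e.IsDiag)
    {u v : V} (huv : s(u, v) ∈ S) (hT : HasOrdering (S.erase s(u, v))) (hno : ¬ HasOrdering S)
    (hlt : edgeDeg S u + edgeDeg S v < S.card) :
    S.card + 3 ≤ 2 * edgeDeg S u + edgeDeg S v ∨ S.card + 3 ≤ edgeDeg S u + 2 * edgeDeg S v := by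
  obtain ⟨l, hnd, hlS, hl⟩ := hT
  obtain ⟨A, hc, -, hAS, h | h⟩ := exists_star_of_not_hasOrdering hS huv hnd hlS hl hno hlt
  · have : A.card ≤ edgeDeg S u :=
      Finset.card_le_card fun e he => Finset.mem_filter.2 ⟨hAS he, h e he⟩
    omega
  · have : A.card ≤ edgeDeg S v :=
      Finset.card_le_card fun e he => Finset.mem_filter.2 ⟨hAS he, h e he⟩
    omega

/-- The insertion lemma at a vertex `u` of degree `Δ` when there are `2Δ - 1` edges. -/
theorem hasOrdering_of_tight {S : Finset (Sym2 V)} (hS : ∀ e ∈ S, ¬ e.IsDiag)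
    {u v : V} (huv : s(u, v) ∈ S) (hT : HasOrdering (S.erase s(u, v)))
    (hm : S.card + 1 = 2 * edgeDeg S u) (hu : 4 ≤ edgeDeg S u) (hv : edgeDeg S v ≤ 2) :
    HasOrdering S := by
  by_contra hno
  have hne : u ≠ v := fun h => hS _ huv (by simp [h])
  have hv2 : edgeDeg S v = 2 := by
    have := degree_bound_of_not_hasOrdering hS huv hT hno (by omega)
    omega
  -- The family has exactly d(u) members and is too large for a star at v, so it is the whole star
  -- at u. This holds for every ordering of the other edges, in particular for the reversed one.
  have key : ∀ l : List (Sym2 V), l.Nodup → l.toFinset = S.erase s(u, v) →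
      l.IsChain EdgeDisjoint → ∀ x, u ∈ x ∧ x ∈ S ↔ x = s(u, v) ∨ ∃ (i : ℕ) (h : i < l.length),
        x = l[i] ∧ ∀ _ : 0 < i, EdgeDisjoint l[i - 1] s(u, v) := by
    intro l hnd hlS hl x
    obtain ⟨A, hc, hA, hAS, h | h⟩ :=
      exists_star_of_not_hasOrdering hS huv hnd hlS hl hno (by omega)
    · have hAeq : A = S.filter (u ∈ ·) := by
        refine Finset.eq_of_subset_of_card_le
          (fun e he => Finset.mem_filter.2 ⟨hAS he, h e he⟩) ?_
        change edgeDeg S u ≤ _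
        omega
      rw [← hA, hAeq, Finset.mem_filter, and_comm]
    · have : A.card ≤ edgeDeg S v :=
        Finset.card_le_card fun e he => Finset.mem_filter.2 ⟨hAS he, h e he⟩
      omega
  obtain ⟨l, hnd, hlS, hl⟩ := hT
  have hmem : ∀ x, x ∈ l ↔ x ≠ s(u, v) ∧ x ∈ S := by
    intro x
    rw [← List.mem_toFinset, hlS, Finset.mem_erase]
  have key1 := key l hnd hlS hl
  have key2 := key l.reverse (List.nodup_reverse.2 hnd) (by rw [List.toFinset_reverse, hlS])
    (List.isChain_reverse.2 (hl.imp fun a b h => h.symm))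
  -- The second edge `g` at v is not at u, so its predecessor meets uv; being disjoint from `g`,
  -- that predecessor contains u.
  obtain ⟨g, hg, hgne⟩ := Finset.exists_mem_ne (s := S.filter (v ∈ ·))
    (by change 1 < edgeDeg S v; omega) s(u, v)
  rw [Finset.mem_filter] at hg
  have hug : u ∉ g := fun h => hgne ((Sym2.mem_and_mem_iff hne).1 ⟨h, hg.2⟩)
  obtain ⟨i, hi, hgi⟩ := List.getElem_of_mem ((hmem g).2 ⟨hgne, hg.1⟩)
  have hi0 : 0 < i := by
    by_contra h0
    exact hug ((key1 g).2 (Or.inr ⟨i, hi, hgi.symm, fun h => absurd h h0⟩)).1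
  have hq : ¬ EdgeDisjoint l[i - 1] s(u, v) := fun h =>
    hug ((key1 g).2 (Or.inr ⟨i, hi, hgi.symm, fun _ => h⟩)).1
  have hqg : EdgeDisjoint l[i - 1] g := by
    have := List.isChain_iff_getElem.1 hl (i - 1) (by omega)
    simp only [Nat.sub_add_cancel hi0, hgi] at this
    exact this
  have huq : u ∈ l[i - 1] := by
    rw [edgeDisjoint_mk_right] at hq
    by_contra h
    exact hq ⟨h, fun h' => hqg v h' hg.2⟩
  have hql := (hmem _).1 (List.getElem_mem (show i - 1 < l.length by omega))
  -- In the reversed ordering `g` comes just before this edge at u, so `g` would have to be disjoint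
  -- from uv, although it contains v.
  rcases (key2 _).1 ⟨huq, hql.2⟩ with h | ⟨j, hj, hj', hjd⟩
  · exact hql.1 h
  · rw [List.getElem_reverse] at hj'
    have hij := (hnd.getElem_inj_iff).1 hj'
    rw [List.length_reverse] at hj
    have hd := hjd (by omega)
    rw [List.getElem_reverse] at hd
    have : l.length - 1 - (j - 1) = i := by omega
    simp only [this, hgi] at hd
    exact (edgeDisjoint_mk_right.1 hd).2 hg.2

end EdgeSets

/-! ### Edge sets represented by coded graphs -/

section Codes

variable {V : Type*}

/-- The image of a pair of indices as an edge. -/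
def edgeOf (φ : ℕ → V) (p : ℕ × ℕ) : Sym2 V := s(φ p.1, φ p.2)

theorem mem_edgeOf {φ : ℕ → V} {p : ℕ × ℕ} {x : V} :
    x ∈ edgeOf φ p ↔ x = φ p.1 ∨ x = φ p.2 := Sym2.mem_iff

variable [DecidableEq V]

/-- `φ` labels the vertices of the coded graph `C` so that its edges become those of `S`. -/
structure Represents (S : Finset (Sym2 V)) (C : ℕ × List (ℕ × ℕ)) (φ : ℕ → V) : Prop where
  inj : ∀ i < C.1, ∀ j < C.1, φ i = φ j → i = j
  bound : ∀ p ∈ C.2, p.1 < C.1 ∧ p.2 < C.1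
  nodup : (C.2.map (edgeOf φ)).Nodup
  toFinset_eq : (C.2.map (edgeOf φ)).toFinset = S

/-- `S` is one of the ten exceptional graphs. -/
def IsExceptional (S : Finset (Sym2 V)) : Prop :=
  ∃ C ∈ exceptionalCodes, ∃ φ : ℕ → V, Represents S C φ

/-- The conclusion of the main theorem for the edge set `S`. -/
def OrderableOrBad (S : Finset (Sym2 V)) : Prop :=
  HasOrdering S ∨ (∃ v, S.card + 1 < 2 * edgeDeg S v) ∨
    (∃ u v, s(u, v) ∈ S ∧ 2 * edgeDeg S u = S.card + 1 ∧ 2 * edgeDeg S v = S.card + 1) ∨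
    IsExceptional S

variable {S : Finset (Sym2 V)} {C : ℕ × List (ℕ × ℕ)} {φ : ℕ → V}

theorem Represents.mem_iff (h : Represents S C φ) {e : Sym2 V} :
    e ∈ S ↔ ∃ p ∈ C.2, edgeOf φ p = e := by
  rw [← h.toFinset_eq, List.mem_toFinset, List.mem_map]

theorem Represents.card_eq (h : Represents S C φ) : S.card = C.2.length := by
  rw [← h.toFinset_eq, List.toFinset_card_of_nodup h.nodup, List.length_map]

theorem Represents.edgeDeg_eq (h : Represents S C φ) {i : ℕ} (hi : i < C.1) :
    edgeDeg S (φ i) = listDeg C.2 i := by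
  unfold edgeDeg listDeg
  have hfil : S.filter (φ i ∈ ·) =
      ((C.2.map (edgeOf φ)).filter fun e => decide (φ i ∈ e)).toFinset := by
    rw [← h.toFinset_eq]
    ext e
    simp
  rw [hfil, List.toFinset_card_of_nodup (h.nodup.filter _),
    ← List.countP_eq_length_filter, List.countP_map]
  refine List.countP_congr fun p hp => ?_
  have hb := h.bound p hp
  simp only [Function.comp_apply, decide_eq_true_eq, mem_edgeOf, Bool.or_eq_true, beq_iff_eq]
  refine or_congr ⟨fun h' => ?_, fun h' => by rw [h']⟩ ⟨fun h' => ?_, fun h' => by rw [h']⟩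
  · exact (h.inj _ hi _ hb.1 h').symm
  · exact (h.inj _ hi _ hb.2 h').symm

/-! ### Soundness and completeness of the path search -/

theorem Represents.edgeDisjoint_iff (h : Represents S C φ) {p q : ℕ × ℕ} (hp : p ∈ C.2)
    (hq : q ∈ C.2) : EdgeDisjoint (edgeOf φ p) (edgeOf φ q) ↔ pairDisjoint p q = true := by
  have hbp := h.bound p hp
  have hbq := h.bound q hq
  have key : ∀ i j, i < C.1 → j < C.1 → (φ i = φ j ↔ i = j) := fun i j hi hj =>
    ⟨h.inj i hi j hj, fun h' => by rw [h']⟩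
  unfold edgeOf
  rw [edgeDisjoint_mk_right]
  simp only [Sym2.mem_iff, pairDisjoint, Bool.and_eq_true, bne_iff_ne, ne_eq, not_or]
  rw [key _ _ hbq.1 hbp.1, key _ _ hbq.1 hbp.2, key _ _ hbq.2 hbp.1, key _ _ hbq.2 hbp.2]
  omega

theorem exists_chain_of_pathFrom (h : Represents S C φ) :
    ∀ (k : ℕ) (a : ℕ × ℕ) (L : List (ℕ × ℕ)), a ∈ C.2 → (∀ p ∈ L, p ∈ C.2) →
      pathFrom k a L = true →
      ∃ l : List (Sym2 V), l.Perm (L.map (edgeOf φ)) ∧ (edgeOf φ a :: l).IsChain EdgeDisjoint := by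
  intro k
  induction k with
  | zero =>
    intro a L _ _ hp
    simp only [pathFrom, List.isEmpty_iff] at hp
    subst hp
    exact ⟨[], by simp, by simp⟩
  | succ k ih =>
    intro a L ha hL hp
    simp only [pathFrom, Bool.or_eq_true, List.isEmpty_iff, List.any_eq_true,
      Bool.and_eq_true] at hp
    rcases hp with rfl | ⟨f, hf, hd, hp⟩
    · exact ⟨[], by simp, by simp⟩
    · obtain ⟨l, hl, hc⟩ := ih f (L.erase f) (hL f hf)
        (fun p hp => hL p (List.mem_of_mem_erase hp)) hp
      refine ⟨edgeOf φ f :: l, ?_, ?_⟩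
      · have := (List.perm_cons_erase hf).map (edgeOf φ)
        exact (hl.cons _).trans this.symm
      · rw [List.isChain_cons]
        refine ⟨?_, hc⟩
        simpa using (h.edgeDisjoint_iff ha (hL f hf)).2 hd

theorem Represents.hasOrdering (h : Represents S C φ) (hp : hasPath C.2 = true) :
    HasOrdering S := by
  simp only [hasPath, List.any_eq_true] at hp
  obtain ⟨a, ha, hp⟩ := hp
  obtain ⟨l, hl, hc⟩ := exists_chain_of_pathFrom h _ a _ ha
    (fun p hp => List.mem_of_mem_erase hp) hp
  have hperm : (edgeOf φ a :: l).Perm (C.2.map (edgeOf φ)) :=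
    (hl.cons _).trans ((List.perm_cons_erase ha).map (edgeOf φ)).symm
  exact ⟨_, hperm.nodup_iff.2 h.nodup, by rw [List.toFinset_eq_of_perm _ _ hperm, h.toFinset_eq],
    hc⟩

/-- Completeness of the search, given enough fuel: this is what lets a failed search refute
orderings of the exceptional graphs. -/
theorem pathFrom_of_chain (h : Represents S C φ) :
    ∀ (k : ℕ) (a : ℕ × ℕ) (L : List (ℕ × ℕ)) (l : List (Sym2 V)), a ∈ C.2 → (∀ p ∈ L, p ∈ C.2) →
      L.length ≤ k → l.Perm (L.map (edgeOf φ)) → (edgeOf φ a :: l).IsChain EdgeDisjoint →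
      pathFrom k a L = true := by
  intro k
  induction k with
  | zero =>
    intro a L l _ _ hk _ _
    simpa [pathFrom] using hk
  | succ k ih =>
    intro a L l ha hL hk hl hc
    simp only [pathFrom, Bool.or_eq_true, List.isEmpty_iff, List.any_eq_true, Bool.and_eq_true]
    rcases l with _ | ⟨y, t⟩
    · left
      simpa using hl.symm.eq_nil
    · right
      obtain ⟨f, hf, rfl⟩ := List.mem_map.1 (hl.mem_iff.1 List.mem_cons_self)
      rw [List.isChain_cons] at hc
      refine ⟨f, hf, (h.edgeDisjoint_iff ha (hL f hf)).1 (hc.1 _ (by simp)), ?_⟩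
      refine ih f (L.erase f) t (hL f hf) (fun p hp => hL p (List.mem_of_mem_erase hp)) ?_ ?_ hc.2
      · rw [List.length_erase_of_mem hf]
        omega
      · exact (hl.trans ((List.perm_cons_erase hf).map (edgeOf φ))).cons_inv

theorem Represents.hasPath (h : Represents S C φ) (hne : S.Nonempty) (hS : HasOrdering S) :
    hasPath C.2 = true := by
  obtain ⟨l, hnd, hlS, hc⟩ := hS
  have hperm : l.Perm (C.2.map (edgeOf φ)) := by
    rw [List.perm_ext_iff_of_nodup hnd h.nodup]
    intro e
    rw [← List.mem_toFinset, hlS, ← h.toFinset_eq, List.mem_toFinset]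
  rcases l with _ | ⟨y, t⟩
  · simp only [List.toFinset_nil] at hlS
    exact absurd hlS.symm hne.ne_empty
  · obtain ⟨a, ha, rfl⟩ := List.mem_map.1 (hperm.mem_iff.1 List.mem_cons_self)
    simp only [Coline.hasPath, List.any_eq_true]
    refine ⟨a, ha, pathFrom_of_chain h _ a _ t ha (fun p hp => List.mem_of_mem_erase hp) ?_ ?_ hc⟩
    · exact (List.length_erase_le ..)
    · exact (hperm.trans ((List.perm_cons_erase ha).map (edgeOf φ))).cons_inv

/-- The tests along the search only prune; soundness rests on the check at the leaf. -/
theorem isoCheck_of_isoSearch {C H : ℕ × List (ℕ × ℕ)} :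
    ∀ (k : ℕ) (σ : List ℕ), isoSearch C H k σ = true → ∃ τ, isoCheck C H τ = true := by
  intro k
  induction k with
  | zero => exact fun σ h => ⟨σ, h⟩
  | succ k ih =>
    intro σ h
    simp only [isoSearch, List.any_eq_true, Bool.and_eq_true] at h
    obtain ⟨x, -, -, h⟩ := h
    exact ih _ h

/-- The images of the edges of `H` cover `S`, and the edge counts agree, so no image is repeated or
superfluous. -/
theorem Represents.of_isoCheck {H : ℕ × List (ℕ × ℕ)} (h : Represents S C φ)
    (hH : ∀ p ∈ H.2, p.1 < H.1 ∧ p.2 < H.1) {σ : List ℕ} (hc : isoCheck C H σ = true) :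
    Represents S H fun i => φ (σ.getD i 0) := by
  simp only [isoCheck, Bool.and_eq_true, beq_iff_eq, decide_eq_true_eq, List.all_eq_true,
    List.any_eq_true] at hc
  obtain ⟨⟨⟨⟨hlen, hnd⟩, hlt⟩, hlen2⟩, hcov⟩ := hc
  have hget : ∀ i < H.1, ∃ hi : i < σ.length, σ.getD i 0 = σ[i] := by
    intro i hi
    exact ⟨by omega, by simp [hlen, hi]⟩
  have hsub : S ⊆ (H.2.map (edgeOf fun i => φ (σ.getD i 0))).toFinset := by
    intro e he
    obtain ⟨p, hp, rfl⟩ := h.mem_iff.1 he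
    obtain ⟨q, hq, hpq⟩ := hcov p hp
    rw [List.mem_toFinset, List.mem_map]
    refine ⟨q, hq, ?_⟩
    simp only [pairSame, pairMap, Bool.or_eq_true, Bool.and_eq_true, beq_iff_eq] at hpq
    simp only [edgeOf]
    rcases hpq with ⟨h1, h2⟩ | ⟨h1, h2⟩
    · rw [← h1, ← h2]
    · rw [← h1, ← h2, Sym2.eq_swap]
  have hcard : (H.2.map (edgeOf fun i => φ (σ.getD i 0))).toFinset.card ≤ S.card := by
    rw [h.card_eq, ← hlen2]
    exact (List.toFinset_card_le _).trans (by simp)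
  have heq := Finset.eq_of_subset_of_card_le hsub hcard
  refine ⟨?_, hH, ?_, heq.symm⟩
  · intro i hi j hj hij
    obtain ⟨hi', hi''⟩ := hget i hi
    obtain ⟨hj', hj''⟩ := hget j hj
    simp only [hi'', hj''] at hij
    have := h.inj _ (hlt _ (List.getElem_mem hi')) _ (hlt _ (List.getElem_mem hj')) hij
    exact (hnd.getElem_inj_iff).1 this
  · refine Multiset.coe_nodup.1 (Multiset.toFinset_card_eq_card_iff_nodup.1 ?_)
    rw [Multiset.coe_card, List.length_map, hlen2, ← h.card_eq, heq]
    rfl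

theorem exceptional_bound : ∀ H ∈ exceptionalCodes, ∀ p ∈ H.2, p.1 < H.1 ∧ p.2 < H.1 := by
  decide

theorem Represents.orderableOrBad (h : Represents S C φ) (hok : codeOk C = true) :
    OrderableOrBad S := by
  simp only [codeOk, Bool.or_eq_true, List.any_eq_true, List.mem_range, decide_eq_true_eq,
    Bool.and_eq_true, beq_iff_eq] at hok
  rcases hok with ((⟨i, hi, hd⟩ | ⟨p, hp, h1, h2⟩) | hp) | ⟨H, hH, -, hiso⟩
  · exact Or.inr (Or.inl ⟨φ i, by rwa [h.card_eq, h.edgeDeg_eq hi]⟩)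
  · have hb := h.bound p hp
    refine Or.inr (Or.inr (Or.inl ⟨φ p.1, φ p.2, h.mem_iff.2 ⟨p, hp, rfl⟩, ?_, ?_⟩))
    · rwa [h.card_eq, h.edgeDeg_eq hb.1]
    · rwa [h.card_eq, h.edgeDeg_eq hb.2]
  · exact Or.inl (h.hasOrdering hp)
  · obtain ⟨σ, hσ⟩ := isoCheck_of_isoSearch _ _ hiso
    exact Or.inr (Or.inr (Or.inr ⟨H, hH, _, h.of_isoCheck (exceptional_bound H hH) hσ⟩))

/-! ### Adding an edge to a coded graph -/

theorem Represents.congr {ψ : ℕ → V} (h : Represents S C φ) (hψ : ∀ i < C.1, ψ i = φ i) :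
    Represents S C ψ := by
  have hmap : C.2.map (edgeOf ψ) = C.2.map (edgeOf φ) := by
    refine List.map_congr_left fun p hp => ?_
    have hb := h.bound p hp
    simp only [edgeOf, hψ _ hb.1, hψ _ hb.2]
  refine ⟨?_, h.bound, by rw [hmap]; exact h.nodup, by rw [hmap]; exact h.toFinset_eq⟩
  intro i hi j hj hij
  rw [hψ i hi, hψ j hj] at hij
  exact h.inj i hi j hj hij

theorem Represents.mono (h : Represents S C φ) {n : ℕ} (hn : C.1 ≤ n)
    (hinj : ∀ i < n, ∀ j < n, φ i = φ j → i = j) : Represents S (n, C.2) φ :=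
  ⟨hinj, fun p hp => ⟨(h.bound p hp).1.trans_le hn, (h.bound p hp).2.trans_le hn⟩, h.nodup,
    h.toFinset_eq⟩

theorem Represents.cons (h : Represents S C φ) {i j : ℕ} (hi : i < C.1) (hj : j < C.1)
    (he : s(φ i, φ j) ∉ S) : Represents (insert s(φ i, φ j) S) (C.1, (i, j) :: C.2) φ := by
  refine ⟨h.inj, ?_, ?_, ?_⟩
  · intro p hp
    rcases List.mem_cons.1 hp with rfl | hp
    · exact ⟨hi, hj⟩
    · exact h.bound p hp
  · rw [List.map_cons, List.nodup_cons]
    refine ⟨fun h' => he ?_, h.nodup⟩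
    rw [← h.toFinset_eq, List.mem_toFinset]
    exact h'
  · rw [List.map_cons, List.toFinset_cons, h.toFinset_eq]
    rfl

theorem Represents.exists_extend (h : Represents S C φ) {w : V} (hw : ∀ i < C.1, φ i ≠ w) :
    ∃ ψ : ℕ → V, Represents S (C.1 + 1, C.2) ψ ∧ (∀ i < C.1, ψ i = φ i) ∧ ψ C.1 = w := by
  have hψ : ∀ i < C.1, Function.update φ C.1 w i = φ i := fun i hi =>
    Function.update_of_ne hi.ne _ _
  refine ⟨Function.update φ C.1 w, (h.congr hψ).mono (Nat.le_succ _) ?_, hψ, by simp⟩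
  intro i hi j hj hij
  rcases Nat.lt_succ_iff_lt_or_eq.1 hi with hi | rfl <;>
    rcases Nat.lt_succ_iff_lt_or_eq.1 hj with hj | rfl
  · rw [hψ i hi, hψ j hj] at hij
    exact h.inj i hi j hj hij
  · rw [hψ i hi, Function.update_self] at hij
    exact absurd hij (hw i hi)
  · rw [hψ j hj, Function.update_self] at hij
    exact absurd hij.symm (hw j hj)
  · rfl

theorem Represents.exists_insert_new (h : Represents S C φ) {i : ℕ} (hi : i < C.1) {w : V}
    (hw : ∀ i < C.1, φ i ≠ w) (he : s(φ i, w) ∉ S) :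
    ∃ D ∈ codeExts C, ∃ ψ, Represents (insert s(φ i, w) S) D ψ := by
  obtain ⟨ψ, hψ, h1, h2⟩ := h.exists_extend hw
  refine ⟨(C.1 + 1, (i, C.1) :: C.2), ?_, ψ, ?_⟩
  · simp only [codeExts, List.mem_append, List.mem_cons, List.mem_map, List.mem_range]
    exact Or.inl (Or.inr ⟨i, hi, rfl⟩)
  · rw [← h1 i hi, ← h2] at he ⊢
    exact hψ.cons (hi.trans (Nat.lt_succ_self _)) (Nat.lt_succ_self _) he

theorem Represents.exists_insert_old (h : Represents S C φ) {i j : ℕ} (hj : j < C.1)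
    (hij : i < j) (he : s(φ i, φ j) ∉ S) :
    ∃ D ∈ codeExts C, ∃ ψ, Represents (insert s(φ i, φ j) S) D ψ := by
  refine ⟨(C.1, (i, j) :: C.2), ?_, φ, h.cons (hij.trans hj) hj he⟩
  simp only [codeExts, List.mem_append, List.mem_flatMap, List.mem_filterMap, List.mem_range]
  refine Or.inr ⟨j, hj, i, hij, ?_⟩
  rw [if_neg]
  rw [List.any_eq_true]
  rintro ⟨p, hp, hpe⟩
  refine he (h.mem_iff.2 ⟨p, hp, ?_⟩)
  simp only [pairSame, Bool.or_eq_true, Bool.and_eq_true, beq_iff_eq] at hpe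
  simp only [edgeOf]
  rcases hpe with ⟨h1, h2⟩ | ⟨h1, h2⟩
  · rw [h1, h2]
  · rw [h1, h2, Sym2.eq_swap]

theorem Represents.exists_insert (h : Represents S C φ) {e : Sym2 V} (hd : ¬ e.IsDiag)
    (he : e ∉ S) : ∃ D ∈ codeExts C, ∃ ψ, Represents (insert e S) D ψ := by
  induction e with
  | _ a b =>
  have hab : a ≠ b := fun h => hd (by simp [h])
  by_cases ha : ∃ i < C.1, φ i = a
  · obtain ⟨i, hi, rfl⟩ := ha
    by_cases hb : ∃ j < C.1, φ j = b
    · obtain ⟨j, hj, rfl⟩ := hb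
      rcases lt_trichotomy i j with hij | rfl | hij
      · exact h.exists_insert_old hj hij he
      · exact absurd rfl hab
      · rw [Sym2.eq_swap] at he ⊢
        exact h.exists_insert_old hi hij he
    · push Not at hb
      exact h.exists_insert_new hi hb he
  · push Not at ha
    by_cases hb : ∃ j < C.1, φ j = b
    · obtain ⟨j, hj, rfl⟩ := hb
      rw [Sym2.eq_swap] at he ⊢
      exact h.exists_insert_new hj ha he
    · push Not at hb
      obtain ⟨ψ, hψ, h1, h2⟩ := h.exists_extend ha
      obtain ⟨χ, hχ, h3, h4⟩ := hψ.exists_extend (w := b) (by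
        intro i hi
        rcases Nat.lt_succ_iff_lt_or_eq.1 hi with hi | rfl
        · rw [h1 i hi]
          exact hb i hi
        · rw [h2]
          exact hab)
      refine ⟨(C.1 + 2, (C.1, C.1 + 1) :: C.2), ?_, χ, ?_⟩
      · simp [codeExts]
      · have h5 : χ C.1 = a := by rw [h3 _ (Nat.lt_succ_self _), h2]
        have h6 : χ (C.1 + 1) = b := h4
        rw [← h5, ← h6] at he ⊢
        exact hχ.cons (by simp) (by simp) he

/-- Add the missing edges one at a time; up to labelling, each addition is one of the enumerated
extensions. -/
theorem Represents.orderableOrBad_of_subset :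
    ∀ (k : ℕ) {S T : Finset (Sym2 V)} {C : ℕ × List (ℕ × ℕ)} {φ : ℕ → V}, Represents T C φ →
      (∀ e ∈ S, ¬ e.IsDiag) → T ⊆ S → S.card = T.card + k → extsOk k C = true →
      OrderableOrBad S := by
  intro k
  induction k with
  | zero =>
    intro S T C φ h _ hTS hc hok
    obtain rfl := Finset.eq_of_subset_of_card_le hTS hc.le
    exact h.orderableOrBad hok
  | succ k ih =>
    intro S T C φ h hS hTS hc hok
    obtain ⟨e, heS, heT⟩ : ∃ e ∈ S, e ∉ T := by
      by_contra! hcon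
      have := Finset.card_le_card hcon
      omega
    obtain ⟨D, hD, ψ, hψ⟩ := h.exists_insert (hS e heS) heT
    simp only [extsOk, List.all_eq_true] at hok
    refine ih hψ hS (Finset.insert_subset heS hTS) ?_ (hok D hD)
    rw [Finset.card_insert_of_notMem heT]
    omega

/-! ### The finite cases -/

theorem orderableOrBad_of_isExceptional_erase {S : Finset (Sym2 V)} (hS : ∀ e ∈ S, ¬ e.IsDiag)
    {e : Sym2 V} (he : e ∈ S) (hT : IsExceptional (S.erase e)) : OrderableOrBad S := by
  obtain ⟨C, hC, φ, h⟩ := hT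
  exact Represents.orderableOrBad_of_subset 1 h hS (Finset.erase_subset _ _)
    (Finset.card_erase_add_one he).symm (List.all_eq_true.1 exceptional_exts_ok C hC)

theorem exists_represents_star {S : Finset (Sym2 V)} (hS : ∀ e ∈ S, ¬ e.IsDiag) (u : V) :
    ∃ φ : ℕ → V, Represents (S.filter (u ∈ ·)) (starCode (edgeDeg S u)) φ := by
  set l := u :: (edgeNbrs S u).toList with hl
  have hnd : l.Nodup := by
    rw [hl, List.nodup_cons, Finset.mem_toList, mem_edgeNbrs hS]
    exact ⟨fun h => hS _ h (by simp), Finset.nodup_toList _⟩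
  have hlen : l.length = edgeDeg S u + 1 := by
    rw [hl, List.length_cons, Finset.length_toList, card_edgeNbrs hS]
  have hget : ∀ i (h : i < l.length), l.getD i u = l[i] := fun i h => by simp [h]
  have hmap : (starCode (edgeDeg S u)).2.map (edgeOf fun i => l.getD i u) =
      (edgeNbrs S u).toList.map fun x => s(u, x) := by
    refine List.ext_getElem (by simp [starCode, card_edgeNbrs hS]) ?_
    intro i h1 h2
    have : i < (edgeNbrs S u).toList.length := by simpa using h2
    simp only [starCode, edgeOf, hl, List.getElem_map, List.getElem_range, List.getD_cons_zero,
      List.getD_cons_succ]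
    rw [List.getD_eq_getElem _ _ this]
  refine ⟨fun i => l.getD i u, ?_, ?_, ?_, ?_⟩
  · intro i hi j hj hij
    change i < edgeDeg S u + 1 at hi
    change j < edgeDeg S u + 1 at hj
    rw [hget i (by omega), hget j (by omega)] at hij
    exact (hnd.getElem_inj_iff).1 hij
  · intro p hp
    simp only [starCode, List.mem_map, List.mem_range] at hp ⊢
    obtain ⟨i, hi, rfl⟩ := hp
    simp [hi]
  · rw [hmap]
    exact (Finset.nodup_toList _).map fun x y h => Sym2.congr_right.1 h
  · rw [hmap, filter_mem_eq_image hS]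
    ext e
    simp

theorem orderableOrBad_of_small {S : Finset (Sym2 V)} (hS : ∀ e ∈ S, ¬ e.IsDiag) {u : V}
    (hm : 2 ≤ S.card) (hu : edgeDeg S u ≤ 3) (h1 : 2 * edgeDeg S u ≤ S.card + 1)
    (h2 : S.card ≤ 2 * edgeDeg S u) : OrderableOrBad S := by
  obtain ⟨φ, h⟩ := exists_represents_star hS u
  have hok := star_exts_ok
  simp only [Bool.and_eq_true] at hok
  obtain ⟨⟨⟨⟨k1, k2⟩, k3⟩, k4⟩, k5⟩ := hok
  refine Represents.orderableOrBad_of_subset (S.card - edgeDeg S u) h hS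
    (Finset.filter_subset _ _) ?_ ?_
  · have := edgeDeg_le_card S u
    change S.card = edgeDeg S u + _
    omega
  · obtain h' | h' | h' | h' | h' : (S.card = 2 ∧ edgeDeg S u = 1) ∨
        (S.card = 3 ∧ edgeDeg S u = 2) ∨ (S.card = 4 ∧ edgeDeg S u = 2) ∨
        (S.card = 5 ∧ edgeDeg S u = 3) ∨ (S.card = 6 ∧ edgeDeg S u = 3) := by omega
    · simpa only [h'.1, h'.2, Nat.reduceSub] using k1
    · simpa only [h'.1, h'.2, Nat.reduceSub] using k2
    · simpa only [h'.1, h'.2, Nat.reduceSub] using k3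
    · simpa only [h'.1, h'.2, Nat.reduceSub] using k4
    · simpa only [h'.1, h'.2, Nat.reduceSub] using k5

end Codes

/-! ### The main induction -/

section Main

variable {V : Type*} [DecidableEq V] {S : Finset (Sym2 V)} {Δ : ℕ}

theorem hasOrdering_of_card_le_one (h : S.card ≤ 1) : HasOrdering S := by
  rcases Nat.le_one_iff_eq_zero_or_eq_one.1 h with h | h
  · rw [Finset.card_eq_zero] at h
    exact ⟨[], by simp, by simp [h], by simp⟩
  · obtain ⟨e, rfl⟩ := Finset.card_eq_one.1 h
    exact ⟨[e], by simp, by simp, by simp⟩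

theorem exists_edge_of_edgeDeg_pos (hS : ∀ e ∈ S, ¬ e.IsDiag) {v : V} (hv : 0 < edgeDeg S v) :
    ∃ w, s(v, w) ∈ S := by
  rw [← card_edgeNbrs hS] at hv
  obtain ⟨w, hw⟩ := Finset.card_pos.1 hv
  exact ⟨w, (mem_edgeNbrs hS).1 hw⟩

theorem notMem_edgeNbrs_self (hS : ∀ e ∈ S, ¬ e.IsDiag) (u : V) : u ∉ edgeNbrs S u :=
  fun h => ne_of_edge hS ((mem_edgeNbrs hS).1 h) rfl

/-- The case of at least `2Δ + 1` edges. -/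
theorem orderableOrBad_of_sparse [Fintype V] (hS : ∀ e ∈ S, ¬ e.IsDiag)
    (ih : ∀ e ∈ S, OrderableOrBad (S.erase e)) (hΔ : ∀ v, edgeDeg S v ≤ Δ)
    (hm : 2 * Δ < S.card) : OrderableOrBad S := by
  obtain ⟨e, he⟩ : S.Nonempty := Finset.card_pos.1 (by omega)
  obtain ⟨v, hv, hmin⟩ := Finset.exists_min_image
    (Finset.univ.filter fun v => 0 < edgeDeg S v) (edgeDeg S)
    ⟨e.out.1, by simpa using edgeDeg_pos he (Sym2.out_fst_mem e)⟩
  simp only [Finset.mem_filter, Finset.mem_univ, true_and] at hv hmin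
  obtain ⟨w, hvw⟩ := exists_edge_of_edgeDeg_pos hS hv
  have hvw' := hmin w (edgeDeg_pos hvw (by simp))
  have hcard := Finset.card_erase_add_one hvw
  rcases ih _ hvw with h | ⟨x, hx⟩ | ⟨x, y, -, hx, -⟩ | h
  · by_contra hcon
    have hno : ¬ HasOrdering S := fun h' => hcon (Or.inl h')
    have hv4 := hΔ v
    have hw4 := hΔ w
    have hb := degree_bound_of_not_hasOrdering hS hvw h hno (by omega)
    -- The vertex w and its neighbours all have degree at least the minimum d(v).
    have hsum : (edgeDeg S w + 1) * edgeDeg S v ≤ 2 * S.card := by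
      refine le_trans ?_ (sum_edgeDeg_le S (insert w (edgeNbrs S w)))
      rw [← card_edgeNbrs hS w,
        ← Finset.card_insert_of_notMem (notMem_edgeNbrs_self hS w)]
      refine Finset.card_nsmul_le_sum _ _ _ fun x hx => hmin x ?_
      rcases Finset.mem_insert.1 hx with rfl | hx
      · exact edgeDeg_pos hvw (by simp)
      · exact edgeDeg_pos ((mem_edgeNbrs hS).1 hx) (by simp)
    have h1 : S.card + 3 ≤ edgeDeg S v + 2 * edgeDeg S w := by omega
    have h2 : 4 ≤ edgeDeg S v := by omega
    have h3 := edgeDeg_le_card S v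
    generalize edgeDeg S v = d at *
    generalize edgeDeg S w = D at *
    generalize S.card = m at *
    -- The two bounds give (m + 5 - d)d ≤ 4m. With d = 4 + a and m = d + b, the left side exceeds
    -- the right by ab + a + 4.
    obtain ⟨a, rfl⟩ := Nat.exists_eq_add_of_le h2
    obtain ⟨b, rfl⟩ := Nat.exists_eq_add_of_le h3
    nlinarith [Nat.zero_le (a * b), Nat.mul_le_mul_left (4 + a) h1]
  · have := edgeDeg_erase_le S s(v, w) x
    have := hΔ x
    omega
  · have := edgeDeg_erase_le S s(v, w) x
    have := hΔ x
    omega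
  · exact orderableOrBad_of_isExceptional_erase hS hvw h

/-- The degrees at a vertex `u` all of whose neighbours have degree at least three. -/
theorem edgeDeg_add_le_of_nbrs (hS : ∀ e ∈ S, ¬ e.IsDiag) {u : V}
    (hu : ∀ v, s(u, v) ∈ S → 3 ≤ edgeDeg S v) :
    4 * edgeDeg S u ≤ 2 * S.card ∧
      ∀ a, a ≠ u → edgeDeg S a + 4 * edgeDeg S u ≤ 2 * S.card + 3 := by
  have h3 : ∀ X ⊆ edgeNbrs S u, X.card * 3 ≤ ∑ x ∈ X, edgeDeg S x := fun X hX =>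
    Finset.card_nsmul_le_sum _ _ _ fun x hx => hu x ((mem_edgeNbrs hS).1 (hX hx))
  constructor
  · have h1 := sum_edgeDeg_le S (insert u (edgeNbrs S u))
    rw [Finset.sum_insert (notMem_edgeNbrs_self hS u)] at h1
    have h2 := h3 _ subset_rfl
    rw [card_edgeNbrs hS] at h2
    omega
  · intro a ha
    -- `a` may itself be a neighbour of u, so only d(u) - 1 neighbours are sure to contribute 3
    -- each.
    have h1 := sum_edgeDeg_le S (insert u (insert a ((edgeNbrs S u).erase a)))
    rw [Finset.sum_insert, Finset.sum_insert (by simp)] at h1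
    · have h2 := h3 _ (Finset.erase_subset a _)
      have h4 := Finset.pred_card_le_card_erase (s := edgeNbrs S u) (a := a)
      rw [card_edgeNbrs hS] at h4
      omega
    · simp [Ne.symm ha, notMem_edgeNbrs_self hS u]

/-- The case of `2Δ` edges. -/
theorem orderableOrBad_of_card_eq (hS : ∀ e ∈ S, ¬ e.IsDiag)
    (ih : ∀ e ∈ S, OrderableOrBad (S.erase e)) (hΔ : ∀ v, edgeDeg S v ≤ Δ) {u : V}
    (hu : edgeDeg S u = Δ) (hm : S.card = 2 * Δ) (h4 : 4 ≤ Δ) : OrderableOrBad S := by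
  by_cases hv : ∃ v, s(u, v) ∈ S ∧ edgeDeg S v ≤ 2
  · obtain ⟨v, huv, hv⟩ := hv
    have hcard := Finset.card_erase_add_one huv
    have hu' := edgeDeg_erase_of_mem huv (v := u) (by simp)
    rcases ih _ huv with h | ⟨x, hx⟩ | ⟨x, y, hxy, hx, hy⟩ | h
    · refine Or.inl ?_
      by_contra hno
      have hb := degree_bound_of_not_hasOrdering hS huv h hno (by omega)
      omega
    · have := edgeDeg_erase_le S s(u, v) x
      have := hΔ x
      omega
    · exfalso
      have hT : ∀ e ∈ S.erase s(u, v), ¬ e.IsDiag := fun e he => hS e (Finset.mem_of_mem_erase he)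
      have hd := card_disjoint_add_edgeDeg (ne_of_edge hT hxy) hxy
      -- The degrees of x and y add up so that every remaining edge meets xy. Now u has degree Δ -
      -- 1, so it is neither x nor y and keeps at most two edges, against Δ ≥ 4.
      have hzero : ((S.erase s(u, v)).filter fun e => x ∉ e ∧ y ∉ e).card = 0 := by omega
      rw [Finset.card_eq_zero, Finset.filter_eq_empty_iff] at hzero
      have hux : u ≠ x := by rintro rfl; omega
      have huy : u ≠ y := by rintro rfl; omega
      have hsub : (S.erase s(u, v)).filter (u ∈ ·) ⊆ {s(u, x), s(u, y)} := by
        intro e he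
        rw [Finset.mem_filter] at he
        have := hzero he.1
        rw [← not_or, not_not] at this
        simp only [Finset.mem_insert, Finset.mem_singleton]
        exact this.imp (fun h => (Sym2.mem_and_mem_iff hux).1 ⟨he.2, h⟩)
          (fun h => (Sym2.mem_and_mem_iff huy).1 ⟨he.2, h⟩)
      have : edgeDeg (S.erase s(u, v)) u ≤ 2 := (Finset.card_le_card hsub).trans Finset.card_le_two
      omega
    · exact orderableOrBad_of_isExceptional_erase hS huv h
  · push Not at hv
    -- Since m = 2Δ, every vertex other than u has degree at most 3; an edge avoiding u then
    -- violates the insertion bound.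
    have hle := (edgeDeg_add_le_of_nbrs hS fun v h => hv v h).2
    obtain ⟨e, he, hue⟩ : ∃ e ∈ S, u ∉ e := by
      by_contra! hcon
      have : edgeDeg S u = S.card := by
        unfold edgeDeg
        rw [Finset.filter_true_of_mem hcon]
      omega
    have hcard := Finset.card_erase_add_one he
    rcases ih _ he with h | ⟨x, hx⟩ | ⟨x, y, hxy, hx, hy⟩ | h
    · refine Or.inl ?_
      by_contra hno
      induction e with
      | _ a b =>
      have ha := hle a (by rintro rfl; simp at hue)
      have hb := hle b (by rintro rfl; simp at hue)
      have := degree_bound_of_not_hasOrdering hS he h hno (by omega)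
      omega
    · have := edgeDeg_erase_le S e x
      have := hΔ x
      omega
    · exfalso
      have h1 := edgeDeg_erase_le S e x
      have h2 := edgeDeg_erase_le S e y
      have hxu : x = u := by
        by_contra hne
        have := hle x hne
        omega
      have hyu : y = u := by
        by_contra hne
        have := hle y hne
        omega
      exact ne_of_edge hS (Finset.mem_of_mem_erase hxy) (hxu.trans hyu.symm)
    · exact orderableOrBad_of_isExceptional_erase hS he h

/-- The case of `2Δ - 1` edges. -/
theorem orderableOrBad_of_card_add_one_eq (hS : ∀ e ∈ S, ¬ e.IsDiag)
    (ih : ∀ e ∈ S, OrderableOrBad (S.erase e)) (hΔ : ∀ v, edgeDeg S v ≤ Δ) {u : V}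
    (hu : edgeDeg S u = Δ) (hm : S.card + 1 = 2 * Δ) (h4 : 4 ≤ Δ) : OrderableOrBad S := by
  obtain ⟨v, huv, hv⟩ : ∃ v, s(u, v) ∈ S ∧ edgeDeg S v ≤ 2 := by
    by_contra! hcon
    have := (edgeDeg_add_le_of_nbrs hS fun v h => hcon v h).1
    omega
  have hcard := Finset.card_erase_add_one huv
  have hu' := edgeDeg_erase_of_mem huv (v := u) (by simp)
  rcases ih _ huv with h | ⟨x, hx⟩ | ⟨x, y, hxy, hx, hy⟩ | h
  · exact Or.inl (hasOrdering_of_tight hS huv h (by omega) (by omega) hv)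
  · have h1 := edgeDeg_erase_le S s(u, v) x
    have h2 := hΔ x
    have hux : u ≠ x := by rintro rfl; omega
    -- Both u and x have degree Δ in `S`, and 2Δ exceeds the number of edges, so they share one.
    have hadj : s(u, x) ∈ S := by
      by_contra hn
      have := edgeDeg_add_le hux hn
      omega
    exact Or.inr (Or.inr (Or.inl ⟨u, x, hadj, by omega, by omega⟩))
  -- Parity: after the deletion, the edge count plus one is 2Δ - 1, which is odd.
  · omega
  · exact orderableOrBad_of_isExceptional_erase hS huv h

theorem orderableOrBad [Fintype V] (S : Finset (Sym2 V)) (hS : ∀ e ∈ S, ¬ e.IsDiag) :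
    OrderableOrBad S := by
  induction S using Finset.strongInduction with
  | _ S ih =>
  have ih' : ∀ e ∈ S, OrderableOrBad (S.erase e) := fun e he =>
    ih _ (Finset.erase_ssubset he) fun f hf => hS f (Finset.mem_of_mem_erase hf)
  rcases Nat.lt_or_ge S.card 2 with h2 | h2
  · exact Or.inl (hasOrdering_of_card_le_one (by omega))
  obtain ⟨e, he⟩ : S.Nonempty := Finset.card_pos.1 (by omega)
  obtain ⟨u, -, hu⟩ := Finset.exists_max_image Finset.univ (edgeDeg S)
    ⟨e.out.1, Finset.mem_univ _⟩
  replace hu := fun v => hu v (Finset.mem_univ v)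
  rcases Nat.lt_or_ge (S.card + 1) (2 * edgeDeg S u) with h | h
  · exact Or.inr (Or.inl ⟨u, h⟩)
  rcases Nat.lt_or_ge (2 * edgeDeg S u) S.card with h' | h'
  · exact orderableOrBad_of_sparse hS ih' hu h'
  rcases Nat.lt_or_ge (edgeDeg S u) 4 with h4 | h4
  · exact orderableOrBad_of_small hS h2 (by omega) h h'
  · obtain h5 | h5 : S.card = 2 * edgeDeg S u ∨ S.card + 1 = 2 * edgeDeg S u := by omega
    · exact orderableOrBad_of_card_eq hS ih' hu rfl h5 h4
    · exact orderableOrBad_of_card_add_one_eq hS ih' hu rfl h5 h4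

/-! ### Obstructions to an ordering -/

/-- No two consecutive entries satisfy `p`, so each pair split off contributes at most one. -/
theorem two_mul_countP_le {α : Type*} {r : α → α → Prop} (p : α → Bool)
    (hp : ∀ a b, r a b → ¬ (p a = true ∧ p b = true)) :
    ∀ l : List α, l.IsChain r → 2 * l.countP p ≤ l.length + 1
  | [], _ => by simp
  | [a], _ => by
    have := List.countP_le_length (p := p) (l := [a])
    simp only [List.length_singleton] at this ⊢
    omega
  | a :: b :: l, h => by
    rw [List.isChain_cons_cons] at h
    have h1 := two_mul_countP_le p hp l h.2.of_cons
    have h2 := hp a b h.1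
    simp only [List.countP_cons, List.length_cons]
    split_ifs with h3 h4 <;> first | omega | exact absurd ⟨h4, h3⟩ h2

theorem HasOrdering.two_mul_edgeDeg_le (h : HasOrdering S) (v : V) :
    2 * edgeDeg S v ≤ S.card + 1 := by
  obtain ⟨l, hnd, rfl, hl⟩ := h
  have := two_mul_countP_le (fun e => decide (v ∈ e))
    (fun a b hab => by simpa using hab v) l hl
  have hfil : l.toFinset.filter (v ∈ ·) = (l.filter fun e => decide (v ∈ e)).toFinset := by
    ext e
    simp
  unfold edgeDeg
  rwa [hfil, List.toFinset_card_of_nodup (hnd.filter _), ← List.countP_eq_length_filter,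
    List.toFinset_card_of_nodup hnd]

theorem HasOrdering.exists_disjoint (h : HasOrdering S) (hS : 2 ≤ S.card) {e : Sym2 V}
    (he : e ∈ S) : ∃ f ∈ S, EdgeDisjoint f e := by
  obtain ⟨l, hnd, rfl, hl⟩ := h
  rw [List.toFinset_card_of_nodup hnd] at hS
  obtain ⟨i, hi, rfl⟩ := List.getElem_of_mem (List.mem_toFinset.1 he)
  rw [List.isChain_iff_getElem] at hl
  rcases Nat.eq_zero_or_pos i with rfl | h0
  · exact ⟨l[1], by simp, (hl 0 (by omega)).symm⟩
  · refine ⟨l[i - 1], by simp, ?_⟩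
    have := hl (i - 1) (by omega)
    simpa only [Nat.sub_add_cancel h0] using this

/-- In the second case d(u) + d(v) = m + 1 leaves no edge disjoint from uv, while in an ordering of
at least two edges uv has a neighbour. -/
theorem not_hasOrdering_of_bad (hS : ∀ e ∈ S, ¬ e.IsDiag) (h2 : 2 ≤ S.card)
    (h : (∃ v, S.card + 1 < 2 * edgeDeg S v) ∨
      (∃ u v, s(u, v) ∈ S ∧ 2 * edgeDeg S u = S.card + 1 ∧ 2 * edgeDeg S v = S.card + 1) ∨
      IsExceptional S) : ¬ HasOrdering S := by
  intro ho
  rcases h with ⟨v, hv⟩ | ⟨u, v, huv, hu, hv⟩ | ⟨C, hC, φ, hφ⟩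
  · exact absurd (ho.two_mul_edgeDeg_le v) (by omega)
  · obtain ⟨f, hf, hfd⟩ := ho.exists_disjoint h2 huv
    have hd := card_disjoint_add_edgeDeg (ne_of_edge hS huv) huv
    have : 0 < (S.filter fun e => u ∉ e ∧ v ∉ e).card :=
      Finset.card_pos.2 ⟨f, Finset.mem_filter.2 ⟨hf, edgeDisjoint_mk_right.1 hfd⟩⟩
    omega
  · have := hφ.hasPath (Finset.card_pos.1 (by omega)) ho
    have h' := List.all_eq_true.1 exceptional_no_path C hC
    simp [this] at h'

end Main

/-! ### From graphs to edge sets -/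

section Graphs

theorem edgeFinset_not_isDiag {V : Type*} (G : SimpleGraph V) [Fintype G.edgeSet] :
    ∀ e ∈ G.edgeFinset, ¬ e.IsDiag :=
  fun _ he => G.not_isDiag_of_mem_edgeFinset he

theorem coline_adj {V : Type*} (G : SimpleGraph V) {e f : G.edgeSet} :
    (coline G).Adj e f ↔ EdgeDisjoint (e : Sym2 V) (f : Sym2 V) := by
  rw [coline, SimpleGraph.compl_adj, SimpleGraph.lineGraph_adj_iff_exists]
  unfold EdgeDisjoint
  constructor
  · rintro ⟨hne, h⟩ x hx hx'
    exact h ⟨hne, x, hx, hx'⟩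
  · intro h
    refine ⟨?_, fun ⟨_, x, hx, hx'⟩ => h x hx hx'⟩
    rintro rfl
    exact h _ (Sym2.out_fst_mem _) (Sym2.out_fst_mem _)

variable {V : Type*} [Fintype V] [DecidableEq V] (G : SimpleGraph V) [DecidableRel G.Adj]

theorem edgeDeg_edgeFinset (v : V) : edgeDeg G.edgeFinset v = G.degree v := by
  rw [← G.card_incidenceFinset_eq_degree, G.incidenceFinset_eq_filter]
  rfl

/-- Nonemptiness matters: the empty list orders the empty set, but a walk has at least one vertex.
-/
theorem traceable_coline_iff (hne : G.edgeFinset.Nonempty) :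
    Traceable (coline G) ↔ HasOrdering G.edgeFinset := by
  constructor
  · rintro ⟨a, b, p, hp⟩
    refine ⟨p.support.map Subtype.val, ?_, ?_, ?_⟩
    · exact hp.isPath.support_nodup.map Subtype.val_injective
    · ext e
      rw [List.mem_toFinset, List.mem_map, SimpleGraph.mem_edgeFinset]
      constructor
      · rintro ⟨x, -, rfl⟩
        exact x.2
      · exact fun he => ⟨⟨e, he⟩, hp.mem_support _, rfl⟩
    · rw [List.isChain_map]
      exact p.isChain_adj_support.imp fun x y h => (coline_adj G).1 h
  · rintro ⟨l, hnd, hl, hc⟩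
    have hmem : ∀ e ∈ l, e ∈ G.edgeSet := fun e he => by
      rw [← SimpleGraph.mem_edgeFinset, ← hl, List.mem_toFinset]
      exact he
    obtain ⟨l', rfl⟩ : ∃ l' : List G.edgeSet, l'.map Subtype.val = l :=
      ⟨l.attachWith _ hmem, by simp⟩
    have hne' : l' ≠ [] := by
      rintro rfl
      rw [← hl] at hne
      simp at hne
    have hc' : l'.IsChain (coline G).Adj := by
      rw [List.isChain_map] at hc
      exact hc.imp fun x y h => (coline_adj G).2 h
    refine ⟨_, _, SimpleGraph.Walk.ofSupport l' hne' hc', ?_⟩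
    intro x
    rw [SimpleGraph.Walk.support_ofSupport]
    refine @List.count_eq_one_of_mem _ instBEqOfDecidableEq _ _ _ hnd.of_map ?_
    have hx : (x : Sym2 V) ∈ (l'.map Subtype.val).toFinset := by
      rw [hl, SimpleGraph.mem_edgeFinset]
      exact x.2
    rw [List.mem_toFinset, List.mem_map] at hx
    obtain ⟨y, hy, hyx⟩ := hx
    rwa [← Subtype.ext hyx]

/-- The list `L` of pairs below `n` lists the edges in `E` without repetition or loops, and each
vertex lies on an edge. -/
structure IsEdgeList (n : ℕ) (L : List (ℕ × ℕ)) (E : Finset (Sym2 (Fin n))) : Prop where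
  bound : ∀ p ∈ L, p.1 < n ∧ p.2 < n
  loopless : ∀ p ∈ L, p.1 ≠ p.2
  nodup : (L.map (edgeOf id)).Nodup
  mem_iff : ∀ a b : Fin n, s(a, b) ∈ E ↔ ∃ p ∈ L, edgeOf id p = s(a.1, b.1)
  cover : ∀ a : Fin n, ∃ b, s(a, b) ∈ E

/-- As every vertex of the listed graph lies on an edge, the labels below `n` correspond exactly to
the support of `G`. -/
theorem isCopy_graphOfEdges_iff {n : ℕ} {L : List (ℕ × ℕ)} {E : Finset (Sym2 (Fin n))}
    (hL : IsEdgeList n L E) (hne : G.edgeFinset.Nonempty) :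
    IsCopy G (graphOfEdges n E) ↔ ∃ φ : ℕ → V, Represents G.edgeFinset (n, L) φ := by
  have hadj : ∀ a b, (graphOfEdges n E).Adj a b ↔ s(a, b) ∈ E := by
    intro a b
    simp only [graphOfEdges, SimpleGraph.fromEdgeSet_adj, Finset.mem_coe]
    refine ⟨fun h => h.1, fun h => ⟨h, ?_⟩⟩
    rintro rfl
    obtain ⟨p, hp, hpe⟩ := (hL.mem_iff _ _).1 h
    have : p.1 = p.2 := by
      simp only [edgeOf, id, Sym2.eq_iff] at hpe
      omega
    exact hL.loopless p hp this
  constructor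
  · rintro ⟨f⟩
    obtain ⟨e, -⟩ := hne
    set φ : ℕ → V := fun i => if h : i < n then (f.symm ⟨i, h⟩ : V) else e.out.1 with hφ
    have hφi : ∀ i (h : i < n), φ i = (f.symm ⟨i, h⟩ : V) := fun i h => by simp [hφ, h]
    have hinj : ∀ i < n, ∀ j < n, φ i = φ j → i = j := by
      intro i hi j hj hij
      rw [hφi i hi, hφi j hj] at hij
      simpa using f.symm.injective (Subtype.ext hij)
    refine ⟨φ, hinj, hL.bound, ?_, ?_⟩
    · refine hL.nodup.of_map.map_on ?_
      intro p hp q hq hpq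
      refine List.inj_on_of_nodup_map hL.nodup hp hq ?_
      have hp' := hL.bound p hp
      have hq' := hL.bound q hq
      simp only [edgeOf, id, Sym2.eq_iff] at hpq ⊢
      exact hpq.imp (fun h => ⟨hinj _ hp'.1 _ hq'.1 h.1, hinj _ hp'.2 _ hq'.2 h.2⟩)
        (fun h => ⟨hinj _ hp'.1 _ hq'.2 h.1, hinj _ hp'.2 _ hq'.1 h.2⟩)
    · ext e
      rw [List.mem_toFinset, List.mem_map, SimpleGraph.mem_edgeFinset]
      constructor
      · rintro ⟨p, hp, rfl⟩
        have hb := hL.bound p hp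
        have h1 : (graphOfEdges n E).Adj ⟨p.1, hb.1⟩ ⟨p.2, hb.2⟩ :=
          (hadj _ _).2 ((hL.mem_iff _ _).2 ⟨p, hp, rfl⟩)
        have h2 := f.symm.map_adj_iff.2 h1
        simp only [edgeOf, SimpleGraph.mem_edgeSet, hφi _ hb.1, hφi _ hb.2]
        exact h2
      · intro he
        induction e with
        | _ x y =>
        rw [SimpleGraph.mem_edgeSet] at he
        have hx : x ∈ G.support := ⟨y, he⟩
        have hy : y ∈ G.support := ⟨x, he.symm⟩
        have h1 : (G.induce G.support).Adj ⟨x, hx⟩ ⟨y, hy⟩ := he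
        obtain ⟨p, hp, hpe⟩ := (hL.mem_iff _ _).1 ((hadj _ _).1 (f.map_adj_iff.2 h1))
        refine ⟨p, hp, ?_⟩
        have key : ∀ z : G.support, φ (f z).1 = z := fun z => by
          rw [hφi _ (f z).2]
          simp
        have hkx : φ (f ⟨x, hx⟩).1 = x := key _
        have hky : φ (f ⟨y, hy⟩).1 = y := key _
        simp only [edgeOf, id, Sym2.eq_iff] at hpe
        simp only [edgeOf]
        rcases hpe with ⟨h1, h2⟩ | ⟨h1, h2⟩
        · rw [h1, h2, hkx, hky]
        · rw [h1, h2, hkx, hky, Sym2.eq_swap]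
  · rintro ⟨φ, h⟩
    have hG : ∀ a b : Fin n, G.Adj (φ a) (φ b) ↔ s(a, b) ∈ E := by
      intro a b
      rw [← SimpleGraph.mem_edgeSet, ← SimpleGraph.mem_edgeFinset, h.mem_iff, hL.mem_iff]
      refine exists_congr fun p => and_congr_right fun hp => ?_
      have hb := hL.bound p hp
      have key : ∀ i j, i < n → j < n → (φ i = φ j ↔ i = j) := fun i j hi hj =>
        ⟨h.inj i hi j hj, fun h' => by rw [h']⟩
      simp only [edgeOf, id, Sym2.eq_iff]
      rw [key _ _ hb.1 a.2, key _ _ hb.1 b.2, key _ _ hb.2 a.2, key _ _ hb.2 b.2]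
    have hsupp : ∀ a : Fin n, φ a ∈ G.support := by
      intro a
      obtain ⟨b, hb⟩ := hL.cover a
      exact ⟨φ b, (hG a b).2 hb⟩
    have hbij : Function.Bijective fun a : Fin n => (⟨φ a, hsupp a⟩ : G.support) := by
      constructor
      · intro a b hab
        exact Fin.ext (h.inj _ a.2 _ b.2 (congrArg Subtype.val hab))
      · rintro ⟨x, hx⟩
        obtain ⟨y, hxy⟩ := SimpleGraph.mem_support G |>.1 hx
        rw [← SimpleGraph.mem_edgeSet, ← SimpleGraph.mem_edgeFinset, h.mem_iff] at hxy
        obtain ⟨p, hp, hpe⟩ := hxy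
        have hb := hL.bound p hp
        have hx : x ∈ edgeOf φ p := by rw [hpe]; simp
        rcases mem_edgeOf.1 hx with rfl | rfl
        · exact ⟨⟨p.1, hb.1⟩, rfl⟩
        · exact ⟨⟨p.2, hb.2⟩, rfl⟩
    refine ⟨(SimpleGraph.Iso.symm ⟨Equiv.ofBijective _ hbij, ?_⟩)⟩
    intro a b
    rw [hadj, ← hG]
    rfl

theorem isExceptional_edgeFinset_iff (hne : G.edgeFinset.Nonempty) :
    IsExceptional G.edgeFinset ↔ IsSporadic G ∨ IsCopy G K3CoronaK1 := by
  simp only [IsExceptional, exceptionalCodes, List.mem_cons, List.not_mem_nil, or_false,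
    exists_eq_or_imp, exists_eq_left, IsSporadic, or_assoc]
  refine or_congr ?_ (or_congr ?_ (or_congr ?_ (or_congr ?_ (or_congr ?_ (or_congr ?_
    (or_congr ?_ (or_congr ?_ (or_congr ?_ ?_))))))))
  all_goals
    refine (isCopy_graphOfEdges_iff G ⟨?_, ?_, ?_, ?_, ?_⟩ hne).symm <;> decide

end Graphs

end Coline

/-! ### The theorem for graphs -/

theorem corollary8 {V : Type*} [Fintype V] [DecidableEq V]
    (G : SimpleGraph V) [DecidableRel G.Adj] (m Δ : ℕ)
    (hm : G.edgeFinset.card = m) (hΔ : G.maxDegree = Δ) (hm2 : 2 ≤ m) :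
    ¬ Coline.Traceable (Coline.coline G) ↔
      (m : ℤ) < 2 * (Δ : ℤ) - 1 ∨
      ((m : ℤ) = 2 * (Δ : ℤ) - 1 ∧ ∃ u v : V, G.Adj u v ∧ G.degree u = Δ ∧ G.degree v = Δ) ∨
      Coline.IsSporadic G ∨
      Coline.IsCopy G Coline.K3CoronaK1 := by
  have hne : G.edgeFinset.Nonempty := Finset.card_pos.1 (by omega)
  have hS := Coline.edgeFinset_not_isDiag G
  obtain ⟨e, -⟩ := hne
  have : Nonempty V := ⟨e.out.1⟩
  have hne : G.edgeFinset.Nonempty := Finset.card_pos.1 (by omega)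
  obtain ⟨w, hw⟩ := G.exists_maximal_degree_vertex
  have hle : ∀ v, G.degree v ≤ Δ := fun v => hΔ ▸ G.degree_le_maxDegree v
  rw [Coline.traceable_coline_iff G hne, ← Coline.isExceptional_edgeFinset_iff G hne]
  constructor
  · intro hno
    rcases Coline.orderableOrBad G.edgeFinset hS with h | ⟨v, hv⟩ | ⟨u, v, huv, hu, hv⟩ | h
    · exact absurd h hno
    · rw [Coline.edgeDeg_edgeFinset] at hv
      have := hle v
      left
      omega
    · rw [Coline.edgeDeg_edgeFinset] at hu hv
      rw [SimpleGraph.mem_edgeFinset, SimpleGraph.mem_edgeSet] at huv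
      have h1 := hle u
      have h2 := hle v
      -- The common degree is (m + 1)/2. If it is Δ, this is (ii); if it is smaller, then m < 2Δ -
      -- 1.
      by_cases h3 : G.degree u = Δ
      · exact Or.inr (Or.inl ⟨by omega, u, v, huv, h3, by omega⟩)
      · left
        omega
    · exact Or.inr (Or.inr h)
  · intro h
    refine Coline.not_hasOrdering_of_bad hS (by omega) ?_
    rcases h with h | ⟨h, u, v, huv, hu, hv⟩ | h
    · refine Or.inl ⟨w, ?_⟩
      rw [Coline.edgeDeg_edgeFinset]
      omega
    · refine Or.inr (Or.inl ⟨u, v, ?_, ?_, ?_⟩)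
      · rwa [SimpleGraph.mem_edgeFinset, SimpleGraph.mem_edgeSet]
      · rw [Coline.edgeDeg_edgeFinset]
        omega
      · rw [Coline.edgeDeg_edgeFinset]
        omega
    · exact Or.inr (Or.inr h)
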